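/- **Conventions.** A *probability algebra* $X=(\Sigma_X,\mu_X)$ is a $\sigma$-complete Boolean algebra $\Sigma_X$ with a countably additive map $\mu_X\colon\Sigma_X\to[0,1]$ such that $\mu_X(0)=0$, $\mu_X(1)=1$ and $\mu_X(E)>0$ for $E\neq 0$. A *morphism of probability algebras* $T\colon X\to Y$ is a Boolean homomorphism $T^*\colon\Sigma_Y\to\Sigma_X$ that preserves countable joins and meets and satisfies $\mu_X(T^*E)=\mu_Y(E)$ for $E\in\Sigma_Y$; one puts $(S\circ T)^*=T^*\circ S^*$. A probability space $(\Omega,\Sigma,\nu)$ has the probability algebra $(\Omega,\nu)_{\mathrm{ProbAlg}}$ given by $\Sigma$ modulo $\nu$-null sets with the induced measure, and a measure-preserving map $S$ induces the morphism $S_{\mathrm{ProbAlg}}$ with $S_{\mathrm{ProbAlg}}^*[E]=[S^{-1}(E)]$. For a probability algebra $X$, let $L^\infty(X)$ be the commutative unital $*$-algebra of all bounded abstractly measurable maps $f\colon X\to\mathbb C$, that is, of all Boolean homomorphisms $f^*\colon\mathrm{Borel}(\mathbb C)\to\Sigma_X$ that preserve countable joins and meets and satisfy $f^*(\{|z|\le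 M\})=1$ for some $M$. The sum (product) of $f$ and $g$ is the composition of the abstractly measurable map $(f,g)\colon X\to\mathbb C^2$ with components $f,g$ and the addition (multiplication) of $\mathbb C$, and the involution is the composition with complex conjugation. Its trace is $\tau(f)=\int_{\mathbb C}z\,d(\mu_X\circ f^*)(z)$. Let $\mathrm{Stone}(X)$ be the set of all unital $*$-homomorphisms $x\colon L^\infty(X)\to\mathbb C$, with the topology of pointwise convergence and the Baire $\sigma$-algebra, which is generated by the continuous functions $\mathrm{Stone}(X)\to\mathbb C$. For a morphism $T\colon X\to Y$ define $\mathrm{Stone}(T)\colon\mathrm{Stone}(X)\to\mathrm{Stone}(Y)$ by $\mathrm{Stone}(T)(x)(f)=x(f\circ T)$, where $(f\circ T)^*=T^*\circ f^*$. **Theorem 1.3 (Continuous model for uncountable abstract systems).** Let $\Gamma$ be an arbitrary group, let $X$ be an arbitrary probability algebra, and let $\Gamma$ act on $X$ by morphisms of probability algebras $T^\gamma\colon X\to X$, $\gamma\in\Gamma$ (so $T^1=\mathrm{id}$ and $T^{\gamma\gamma'}=T^\gamma\circ T^{\gamma'}$). Then $\mathrm{Stone}(X)$ is a compact Hausdorff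 space, and there is a unique Radon (that is, compact $G_\delta$ inner regular) probability measure $\mu_{\mathrm{Stone}(X)}$ on its Baire $\sigma$-algebra such that $$\int_{\mathrm{Stone}(X)}x(f)\,d\mu_{\mathrm{Stone}(X)}(x)=\tau(f)\qquad\text{for all }f\in L^\infty(X).$$ Moreover, the maps $\mathrm{Stone}(T^\gamma)$, $\gamma\in\Gamma$, are homeomorphisms of $\mathrm{Stone}(X)$ that preserve $\mu_{\mathrm{Stone}(X)}$ and form an action of $\Gamma$ on $\mathrm{Stone}(X)$, and there is an isomorphism of probability algebras $\mathfrak A\colon X\to(\mathrm{Stone}(X),\mu_{\mathrm{Stone}(X)})_{\mathrm{ProbAlg}}$ such that $$\mathrm{Stone}(T^\gamma)_{\mathrm{ProbAlg}}\circ\mathfrak A=\mathfrak A\circ T^\gamma\qquad\text{for all }\gamma\in\Gamma.$$ -/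

import Mathlib

open CategoryTheory MeasureTheory

universe u v

noncomputable section

/-! ## σ-complete Boolean algebras, abstract measurable maps, probability algebras -/

/-- A morphism of σ-complete Boolean algebras: a homomorphism of Boolean algebras that preserves
countable joins and countable meets (whenever these exist, so always, in a σ-complete algebra). -/
@[ext]
structure SigmaHom (A : Type u) (B : Type v) [BooleanAlgebra A] [BooleanAlgebra B] where
  toFun : A → B
  map_bot : toFun ⊥ = ⊥
  map_top : toFun ⊤ = ⊤
  map_sup : ∀ a b, toFun (a ⊔ b) = toFun a ⊔ toFun b
  map_inf : ∀ a b, toFun (a ⊓ b) = toFun a ⊓ toFun b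
  map_compl : ∀ a, toFun aᶜ = (toFun a)ᶜ
  map_lub : ∀ (E : ℕ → A) (s : A), IsLUB (Set.range E) s → IsLUB (Set.range (toFun ∘ E)) (toFun s)
  map_glb : ∀ (E : ℕ → A) (s : A), IsGLB (Set.range E) s → IsGLB (Set.range (toFun ∘ E)) (toFun s)

namespace SigmaHom

instance {A : Type*} {B : Type*} [BooleanAlgebra A] [BooleanAlgebra B] :
    CoeFun (SigmaHom A B) (fun _ => A → B) := ⟨SigmaHom.toFun⟩

/-- The identity. -/
def id (A : Type*) [BooleanAlgebra A] : SigmaHom A A where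
  toFun a := a
  map_bot := rfl
  map_top := rfl
  map_sup _ _ := rfl
  map_inf _ _ := rfl
  map_compl _ := rfl
  map_lub _ _ h := h
  map_glb _ _ h := h

/-- `ψ.comp φ` is `ψ ∘ φ`. -/
def comp {A : Type*} {B : Type*} {C : Type*} [BooleanAlgebra A] [BooleanAlgebra B]
    [BooleanAlgebra C] (ψ : SigmaHom B C) (φ : SigmaHom A B) : SigmaHom A C where
  toFun a := ψ (φ a)
  map_bot := by rw [φ.map_bot, ψ.map_bot]
  map_top := by rw [φ.map_top, ψ.map_top]
  map_sup a b := by rw [φ.map_sup, ψ.map_sup]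
  map_inf a b := by rw [φ.map_inf, ψ.map_inf]
  map_compl a := by rw [φ.map_compl, ψ.map_compl]
  map_lub E s h := ψ.map_lub _ _ (φ.map_lub E s h)
  map_glb E s h := ψ.map_glb _ _ (φ.map_glb E s h)

end SigmaHom

/-- A probability algebra: a σ-complete Boolean algebra with a countably additive probability
measure that is strictly positive on non-zero elements. -/
structure ProbAlg where
  carrier : Type u
  [str : BooleanAlgebra carrier]
  exists_lub : ∀ E : ℕ → carrier, ∃ s, IsLUB (Set.range E) s
  exists_glb : ∀ E : ℕ → carrier, ∃ s, IsGLB (Set.range E) s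
  μ : carrier → ℝ
  μ_mem : ∀ a, μ a ∈ Set.Icc (0 : ℝ) 1
  μ_bot : μ ⊥ = 0
  μ_top : μ ⊤ = 1
  μ_hasSum : ∀ (E : ℕ → carrier) (s : carrier), Pairwise (fun m n => E m ⊓ E n = ⊥) →
    IsLUB (Set.range E) s → HasSum (fun n => μ (E n)) (μ s)
  μ_pos : ∀ a, a ≠ ⊥ → 0 < μ a

namespace ProbAlg

instance : CoeSort ProbAlg.{u} (Type u) := ⟨ProbAlg.carrier⟩

instance (X : ProbAlg.{u}) : BooleanAlgebra X := X.str

/-- A morphism of probability algebras `X ⟶ Y` is a measure-preserving σ-homomorphism in the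
opposite direction, from the algebra of `Y` to the algebra of `X`. -/
@[ext]
structure Hom (X : ProbAlg.{u}) (Y : ProbAlg.{v}) where
  pull : SigmaHom Y X
  μ_pull : ∀ E : Y, X.μ (pull E) = Y.μ E

/-- The category of probability algebras; composition is the reverse of the composition of the
underlying σ-homomorphisms. -/
instance : Category ProbAlg.{u} where
  Hom X Y := Hom X Y
  id X := ⟨SigmaHom.id X, fun _ => rfl⟩
  comp S T := ⟨S.pull.comp T.pull, fun E => (S.μ_pull _).trans (T.μ_pull E)⟩

end ProbAlg

/-- An abstractly measurable map from (the abstract measurable space with σ-algebra) `A` to the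
measurable space `Ω`: a σ-homomorphism from the σ-algebra of `Ω` to `A`. -/
abbrev AbsMap (A : Type u) [BooleanAlgebra A] (Ω : Type v) [MeasurableSpace Ω] : Type (max u v) :=
  SigmaHom (Subtype (MeasurableSet : Set Ω → Prop)) A

namespace AbsMap

theorem isLUB_iUnion {Ω : Type*} [MeasurableSpace Ω]
    (E : ℕ → Subtype (MeasurableSet : Set Ω → Prop)) :
    IsLUB (Set.range E) ⟨⋃ n, (E n : Set Ω), MeasurableSet.iUnion fun n => (E n).2⟩ := by
  constructor
  · rintro _ ⟨n, rfl⟩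
    exact Set.subset_iUnion (fun n => (E n : Set Ω)) n
  · intro F hF
    exact Set.iUnion_subset fun n => hF ⟨n, rfl⟩

theorem isGLB_iInter {Ω : Type*} [MeasurableSpace Ω]
    (E : ℕ → Subtype (MeasurableSet : Set Ω → Prop)) :
    IsGLB (Set.range E) ⟨⋂ n, (E n : Set Ω), MeasurableSet.iInter fun n => (E n).2⟩ := by
  constructor
  · rintro _ ⟨n, rfl⟩
    exact Set.iInter_subset (fun n => (E n : Set Ω)) n
  · intro F hF
    exact Set.subset_iInter fun n => hF ⟨n, rfl⟩

/-- The pullback `B ↦ g⁻¹(B)` along a measurable map. -/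
def ofMeasurable {Ω : Type*} {Ω' : Type*} [MeasurableSpace Ω] [MeasurableSpace Ω'] (g : Ω → Ω')
    (hg : Measurable g) : AbsMap (Subtype (MeasurableSet : Set Ω → Prop)) Ω' where
  toFun B := ⟨g ⁻¹' B, hg B.2⟩
  map_bot := rfl
  map_top := rfl
  map_sup _ _ := rfl
  map_inf _ _ := rfl
  map_compl _ := rfl
  map_lub E s h := by
    obtain rfl := h.unique (isLUB_iUnion E)
    have h1 := isLUB_iUnion fun n =>
      (⟨g ⁻¹' (E n), hg (E n).2⟩ : Subtype (MeasurableSet : Set Ω → Prop))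
    have h2 : (⟨g ⁻¹' ⋃ n, (E n : Set Ω'), hg (MeasurableSet.iUnion fun n => (E n).2)⟩ :
        Subtype (MeasurableSet : Set Ω → Prop)) =
        ⟨⋃ n, g ⁻¹' (E n : Set Ω'), MeasurableSet.iUnion fun n => hg (E n).2⟩ :=
      Subtype.ext Set.preimage_iUnion
    rw [← h2] at h1
    exact h1
  map_glb E s h := by
    obtain rfl := h.unique (isGLB_iInter E)
    have h1 := isGLB_iInter fun n =>
      (⟨g ⁻¹' (E n), hg (E n).2⟩ : Subtype (MeasurableSet : Set Ω → Prop))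
    have h2 : (⟨g ⁻¹' ⋂ n, (E n : Set Ω'), hg (MeasurableSet.iInter fun n => (E n).2)⟩ :
        Subtype (MeasurableSet : Set Ω → Prop)) =
        ⟨⋂ n, g ⁻¹' (E n : Set Ω'), MeasurableSet.iInter fun n => hg (E n).2⟩ :=
      Subtype.ext Set.preimage_iInter
    rw [← h2] at h1
    exact h1

/-- The composition `g ∘ f` of an abstractly measurable map `f` with a measurable map `g`. -/
def post {A : Type*} [BooleanAlgebra A] {Ω : Type*} {Ω' : Type*} [MeasurableSpace Ω]
    [MeasurableSpace Ω'] (f : AbsMap A Ω) (g : Ω → Ω') (hg : Measurable g) : AbsMap A Ω' :=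
  SigmaHom.comp f (ofMeasurable g hg)

open scoped Classical in
/-- The constant map with value `c`. -/
def const (A : Type*) [BooleanAlgebra A] {Ω : Type*} [MeasurableSpace Ω] (c : Ω) :
    AbsMap A Ω where
  toFun B := if c ∈ (B : Set Ω) then ⊤ else ⊥
  map_bot := if_neg (fun h => h)
  map_top := if_pos trivial
  map_sup B B' := by
    by_cases h : c ∈ (B : Set Ω) <;> by_cases h' : c ∈ (B' : Set Ω) <;> simp [h, h']
  map_inf B B' := by
    by_cases h : c ∈ (B : Set Ω) <;> by_cases h' : c ∈ (B' : Set Ω) <;> simp [h, h']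
  map_compl B := by
    by_cases h : c ∈ (B : Set Ω) <;> simp [h]
  map_lub E s h := by
    obtain rfl := h.unique (isLUB_iUnion E)
    constructor
    · rintro _ ⟨n, rfl⟩
      by_cases hn : c ∈ (E n : Set Ω)
      · have : c ∈ ⋃ n, (E n : Set Ω) := Set.mem_iUnion.2 ⟨n, hn⟩
        simp only [if_pos this]
        exact le_top
      · simp only [Function.comp_apply, if_neg hn]
        exact bot_le
    · intro a ha
      by_cases hc : c ∈ ⋃ n, (E n : Set Ω)
      · obtain ⟨n, hn⟩ := Set.mem_iUnion.1 hc
        have h1 := ha ⟨n, rfl⟩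
        simp only [Function.comp_apply, if_pos hn] at h1
        simp only [if_pos hc]
        exact h1
      · simp only [if_neg hc]
        exact bot_le
  map_glb E s h := by
    obtain rfl := h.unique (isGLB_iInter E)
    constructor
    · rintro _ ⟨n, rfl⟩
      by_cases hn : c ∈ (E n : Set Ω)
      · simp only [Function.comp_apply, if_pos hn]
        exact le_top
      · have : c ∉ ⋂ n, (E n : Set Ω) := fun h => hn (Set.mem_iInter.1 h n)
        simp only [if_neg this]
        exact bot_le
    · intro a ha
      by_cases hc : c ∈ ⋂ n, (E n : Set Ω)
      · simp only [if_pos hc]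
        exact le_top
      · obtain ⟨n, hn⟩ : ∃ n, c ∉ (E n : Set Ω) := by
          by_contra hcon
          push Not at hcon
          exact hc (Set.mem_iInter.2 hcon)
        have h1 := ha ⟨n, rfl⟩
        simp only [Function.comp_apply, if_neg hn] at h1
        simp only [if_neg hc]
        exact h1

end AbsMap

/-! ## The tracial algebra `L^∞(X)` of a probability algebra -/

/-- The closed disc `{z : |z| ≤ M}` as an element of the Borel σ-algebra of `ℂ`. -/
def disc (M : ℝ) : Subtype (MeasurableSet : Set ℂ → Prop) :=
  ⟨Metric.closedBall 0 M, measurableSet_closedBall⟩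

/-- `L^∞(X)`: the bounded abstractly measurable maps from `X` to `ℂ`. -/
@[ext]
structure LInf (X : ProbAlg.{u}) where
  val : AbsMap X ℂ
  bdd : ∃ M : ℝ, val (disc M) = ⊤

namespace LInf

variable {X : ProbAlg.{u}} {Y : ProbAlg.{v}}

/-- `h = f + g` in `L^∞(X)`: `h` is the composition of addition `ℂ × ℂ → ℂ` with the abstractly
measurable map `(f, g) : X → ℂ × ℂ`, that is, the one with components `f` and `g`. -/
def IsSum (f g h : LInf X) : Prop :=
  ∃ P : AbsMap X (ℂ × ℂ), P.post Prod.fst measurable_fst = f.val ∧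
    P.post Prod.snd measurable_snd = g.val ∧
    P.post (fun z => z.1 + z.2) (measurable_fst.add measurable_snd) = h.val

/-- `h = f * g` in `L^∞(X)`. -/
def IsProd (f g h : LInf X) : Prop :=
  ∃ P : AbsMap X (ℂ × ℂ), P.post Prod.fst measurable_fst = f.val ∧
    P.post Prod.snd measurable_snd = g.val ∧
    P.post (fun z => z.1 * z.2) (measurable_fst.mul measurable_snd) = h.val

/-- The involution of `L^∞(X)`: the composition with complex conjugation. -/
def conj (f : LInf X) : LInf X :=
  ⟨f.val.post (fun z => star z) continuous_star.measurable, by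
    obtain ⟨M, hM⟩ := f.2
    refine ⟨M, Eq.trans ?_ hM⟩
    refine congrArg f.val.toFun ?_
    apply Subtype.ext
    ext z
    simp [disc, AbsMap.ofMeasurable]⟩

/-- The constants of `L^∞(X)`. -/
def const (X : ProbAlg.{u}) (c : ℂ) : LInf X :=
  ⟨AbsMap.const X c, ‖c‖, if_pos (by simp [disc])⟩

/-- The Koopman operator `L^∞(T) : L^∞(Y) → L^∞(X)`, `f ↦ f ∘ T`, of `T : X ⟶ Y`. -/
def koopman (T : ProbAlg.Hom X Y) (f : LInf Y) : LInf X :=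
  ⟨T.pull.comp f.val, by
    obtain ⟨M, hM⟩ := f.2
    refine ⟨M, ?_⟩
    change T.pull (f.val (disc M)) = ⊤
    rw [hM, T.pull.map_top]⟩

/-- The law of `f ∈ L^∞(X)`, the Borel probability measure `B ↦ μ_X(f^*(B))` on `ℂ`. -/
def law (f : LInf X) : Measure ℂ :=
  Measure.ofMeasurable (fun B hB => ENNReal.ofReal (X.μ (f.val ⟨B, hB⟩)))
    (by
      have h : f.val ⟨∅, MeasurableSet.empty⟩ = ⊥ := f.val.map_bot
      rw [h, X.μ_bot, ENNReal.ofReal_zero])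
    (by
      intro E hE hd
      have h1 := f.val.map_lub _ _ (AbsMap.isLUB_iUnion fun n => ⟨E n, hE n⟩)
      have h2 := X.μ_hasSum _ _ (fun m n hmn => by
        change f.val ⟨E m, hE m⟩ ⊓ f.val ⟨E n, hE n⟩ = ⊥
        rw [← f.val.map_inf, ← f.val.map_bot]
        congr 1
        exact Subtype.ext (Set.disjoint_iff_inter_eq_empty.1 (hd hmn))) h1
      rw [← h2.tsum_eq]
      exact ENNReal.ofReal_tsum_of_nonneg (fun n => (X.μ_mem _).1) h2.summable)

/-- The trace `τ(f) = ∫_X f dμ_X` on `L^∞(X)`. -/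
def trace (f : LInf X) : ℂ := ∫ z, z ∂f.law

end LInf

/-! ## The canonical model -/

/-- The underlying set of the canonical model `Stone(X)`, the Gelfand spectrum of `L^∞(X)`: all
unital *-homomorphisms from `L^∞(X)` to `ℂ`. (Homogeneity is `map_prod` with `map_const`.) -/
@[ext]
structure Stone (X : ProbAlg.{u}) where
  toFun : LInf X → ℂ
  map_sum : ∀ f g h, LInf.IsSum f g h → toFun h = toFun f + toFun g
  map_prod : ∀ f g h, LInf.IsProd f g h → toFun h = toFun f * toFun g
  map_conj : ∀ f, toFun f.conj = star (toFun f)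
  map_const : ∀ c, toFun (LInf.const X c) = c

/-- The Baire σ-algebra of a compact space `K`, generated by the continuous functions `K → ℂ`. -/
@[reducible]
def baire (K : Type u) [TopologicalSpace K] : MeasurableSpace K :=
  ⨆ f : C(K, ℂ), MeasurableSpace.comap f (borel ℂ)

namespace Stone

variable {X : ProbAlg.{u}} {Y : ProbAlg.{v}}

/-- The topology of pointwise convergence. -/
instance (X : ProbAlg.{u}) : TopologicalSpace (Stone X) :=
  TopologicalSpace.induced Stone.toFun inferInstance

instance (X : ProbAlg.{u}) : MeasurableSpace (Stone X) := baire (Stone X)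

/-- The map `Stone(T) : Stone(X) → Stone(Y)`, `x ↦ x ∘ L^∞(T)`, of `T : X ⟶ Y`. -/
def map (T : ProbAlg.Hom X Y) (x : Stone X) : Stone Y where
  toFun f := x.toFun (f.koopman T)
  map_sum f g h := by
    rintro ⟨P, h1, h2, h3⟩
    refine x.map_sum _ _ _ ⟨T.pull.comp P, ?_, ?_, ?_⟩
    · exact congrArg T.pull.comp h1
    · exact congrArg T.pull.comp h2
    · exact congrArg T.pull.comp h3
  map_prod f g h := by
    rintro ⟨P, h1, h2, h3⟩
    refine x.map_prod _ _ _ ⟨T.pull.comp P, ?_, ?_, ?_⟩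
    · exact congrArg T.pull.comp h1
    · exact congrArg T.pull.comp h2
    · exact congrArg T.pull.comp h3
  map_conj f := x.map_conj (f.koopman T)
  map_const c := by
    refine Eq.trans (congrArg x.toFun ?_) (x.map_const c)
    apply LInf.ext
    apply SigmaHom.ext
    funext B
    change T.pull (AbsMap.const Y c B) = AbsMap.const X c B
    by_cases h : c ∈ (B : Set ℂ)
    · simp [AbsMap.const, h, T.pull.map_top]
    · simp [AbsMap.const, h, T.pull.map_bot]

/-- `ν` is the measure `μ_{Stone(X)}` of the canonical model: a Radon (compact `G_δ` inner regular)
probability measure on the Baire σ-algebra that represents the trace, that is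
`∫ x(f) dν(x) = τ(f)` for all `f ∈ L^∞(X)`, where `f` is identified with the continuous function
`x ↦ x(f)` on the spectrum. -/
structure IsModelMeasure (X : ProbAlg.{u}) (ν : ProbabilityMeasure (Stone X)) : Prop where
  radon : (ν : Measure (Stone X)).InnerRegularWRT (fun K => IsCompact K ∧ IsGδ K) MeasurableSet
  represents : ∀ f : LInf X, ∫ x : Stone X, x.toFun f ∂(ν : Measure (Stone X)) = f.trace

end Stone

/-! ## The probability algebra of a concrete probability space -/

section Concrete

variable {Ω : Type u} [MeasurableSpace Ω]

/-- Measurable sets are identified if their symmetric difference is null. -/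
def nullSetoid (ν : Measure Ω) : Setoid (Subtype (MeasurableSet : Set Ω → Prop)) where
  r E F := ν (symmDiff (E : Set Ω) F) = 0
  iseqv := by
    refine ⟨fun E => by simp, fun h => by rwa [symmDiff_comm], fun h h' => ?_⟩
    rw [measure_symmDiff_eq_zero_iff] at *
    exact h.trans h'

/-- The quotient of the σ-algebra of `Ω` by the null ideal of `ν`. -/
def NullQuot (ν : Measure Ω) : Type u := Quotient (nullSetoid ν)

namespace NullQuot

variable {ν : Measure Ω}

/-- The class of a measurable set. -/
def mk (ν : Measure Ω) (E : Subtype (MeasurableSet : Set Ω → Prop)) : NullQuot ν :=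
  Quotient.mk (nullSetoid ν) E

theorem mk_eq {E F : Subtype (MeasurableSet : Set Ω → Prop)} :
    mk ν E = mk ν F ↔ (E : Set Ω) =ᵐ[ν] (F : Set Ω) :=
  (Quotient.eq (r := nullSetoid ν)).trans measure_symmDiff_eq_zero_iff

theorem exists_rep (a : NullQuot ν) : ∃ E, mk ν E = a := Quotient.exists_rep a

theorem rel_iff {E F : Subtype (MeasurableSet : Set Ω → Prop)} :
    (nullSetoid ν) E F ↔ (E : Set Ω) =ᵐ[ν] (F : Set Ω) := measure_symmDiff_eq_zero_iff

/-- The Boolean operations descend from measurable sets. -/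
instance : BooleanAlgebra (NullQuot ν) where
  sup := Quotient.map₂ (· ⊔ ·) (fun _ _ h _ _ h' =>
    rel_iff.2 ((rel_iff.1 h).union (rel_iff.1 h')))
  inf := Quotient.map₂ (· ⊓ ·) (fun _ _ h _ _ h' =>
    rel_iff.2 ((rel_iff.1 h).inter (rel_iff.1 h')))
  compl := Quotient.map (·ᶜ) (fun _ _ h => rel_iff.2 (rel_iff.1 h).compl)
  top := mk ν ⊤
  bot := mk ν ⊥
  le := Quotient.lift₂ (fun E F => (E : Set Ω) ≤ᵐ[ν] (F : Set Ω)) (fun _ _ _ _ h h' => propext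
    (Filter.eventuallyLE_congr (rel_iff.1 h) (rel_iff.1 h')))
  le_refl a := by
    obtain ⟨E, rfl⟩ := exists_rep a
    exact Filter.EventuallyLE.refl _ _
  le_trans a b c := by
    obtain ⟨E, rfl⟩ := exists_rep a
    obtain ⟨F, rfl⟩ := exists_rep b
    obtain ⟨G, rfl⟩ := exists_rep c
    exact fun h h' => Filter.EventuallyLE.trans h h'
  le_antisymm a b := by
    obtain ⟨E, rfl⟩ := exists_rep a
    obtain ⟨F, rfl⟩ := exists_rep b
    exact fun h h' => mk_eq.2 (Filter.EventuallyLE.antisymm h h')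
  le_sup_left a b := by
    obtain ⟨E, rfl⟩ := exists_rep a
    obtain ⟨F, rfl⟩ := exists_rep b
    exact Filter.Eventually.of_forall fun _ h => Or.inl h
  le_sup_right a b := by
    obtain ⟨E, rfl⟩ := exists_rep a
    obtain ⟨F, rfl⟩ := exists_rep b
    exact Filter.Eventually.of_forall fun _ h => Or.inr h
  sup_le a b c := by
    obtain ⟨E, rfl⟩ := exists_rep a
    obtain ⟨F, rfl⟩ := exists_rep b
    obtain ⟨G, rfl⟩ := exists_rep c
    intro h h'
    filter_upwards [h, h'] with x hx hx' hxx
    exact hxx.elim hx hx'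
  inf_le_left a b := by
    obtain ⟨E, rfl⟩ := exists_rep a
    obtain ⟨F, rfl⟩ := exists_rep b
    exact Filter.Eventually.of_forall fun _ h => h.1
  inf_le_right a b := by
    obtain ⟨E, rfl⟩ := exists_rep a
    obtain ⟨F, rfl⟩ := exists_rep b
    exact Filter.Eventually.of_forall fun _ h => h.2
  le_inf a b c := by
    obtain ⟨E, rfl⟩ := exists_rep a
    obtain ⟨F, rfl⟩ := exists_rep b
    obtain ⟨G, rfl⟩ := exists_rep c
    intro h h'
    filter_upwards [h, h'] with x hx hx' hxx
    exact ⟨hx hxx, hx' hxx⟩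
  le_sup_inf a b c := by
    obtain ⟨E, rfl⟩ := exists_rep a
    obtain ⟨F, rfl⟩ := exists_rep b
    obtain ⟨G, rfl⟩ := exists_rep c
    refine Filter.Eventually.of_forall fun x h => ?_
    have h' : (x ∈ (E : Set Ω) ∨ x ∈ (F : Set Ω)) ∧ (x ∈ (E : Set Ω) ∨ x ∈ (G : Set Ω)) := h
    change x ∈ (E : Set Ω) ∨ (x ∈ (F : Set Ω) ∧ x ∈ (G : Set Ω))
    tauto
  inf_compl_le_bot a := by
    obtain ⟨E, rfl⟩ := exists_rep a
    exact Filter.Eventually.of_forall fun _ h => h.2 h.1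
  top_le_sup_compl a := by
    obtain ⟨E, rfl⟩ := exists_rep a
    exact Filter.Eventually.of_forall fun x _ => Classical.em (x ∈ (E : Set Ω))
  le_top a := by
    obtain ⟨E, rfl⟩ := exists_rep a
    exact Filter.Eventually.of_forall fun _ _ => trivial
  bot_le a := by
    obtain ⟨E, rfl⟩ := exists_rep a
    exact Filter.Eventually.of_forall fun _ h => False.elim h

theorem mk_le {E F : Subtype (MeasurableSet : Set Ω → Prop)} :
    mk ν E ≤ mk ν F ↔ (E : Set Ω) ≤ᵐ[ν] (F : Set Ω) := Iff.rfl

theorem isLUB_mk (E : ℕ → Subtype (MeasurableSet : Set Ω → Prop)) :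
    IsLUB (Set.range fun n => mk ν (E n))
      (mk ν ⟨⋃ n, (E n : Set Ω), MeasurableSet.iUnion fun n => (E n).2⟩) := by
  constructor
  · rintro _ ⟨n, rfl⟩
    exact Filter.Eventually.of_forall (Set.subset_iUnion (fun n => (E n : Set Ω)) n)
  · intro a ha
    obtain ⟨F, rfl⟩ := exists_rep a
    have h : ∀ᵐ x ∂ν, ∀ n, x ∈ (E n : Set Ω) → x ∈ (F : Set Ω) :=
      ae_all_iff.2 fun n => mk_le.1 (ha ⟨n, rfl⟩)
    rw [mk_le]
    filter_upwards [h] with x hx hxx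
    obtain ⟨n, hn⟩ := Set.mem_iUnion.1 hxx
    exact hx n hn

theorem isGLB_mk (E : ℕ → Subtype (MeasurableSet : Set Ω → Prop)) :
    IsGLB (Set.range fun n => mk ν (E n))
      (mk ν ⟨⋂ n, (E n : Set Ω), MeasurableSet.iInter fun n => (E n).2⟩) := by
  constructor
  · rintro _ ⟨n, rfl⟩
    exact Filter.Eventually.of_forall (Set.iInter_subset (fun n => (E n : Set Ω)) n)
  · intro a ha
    obtain ⟨F, rfl⟩ := exists_rep a
    have h : ∀ᵐ x ∂ν, ∀ n, x ∈ (F : Set Ω) → x ∈ (E n : Set Ω) :=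
      ae_all_iff.2 fun n => mk_le.1 (ha ⟨n, rfl⟩)
    rw [mk_le]
    filter_upwards [h] with x hx hxx
    exact Set.mem_iInter.2 fun n => hx n hxx

theorem exists_reps (E : ℕ → NullQuot ν) :
    ∃ F : ℕ → Subtype (MeasurableSet : Set Ω → Prop), E = fun n => mk ν (F n) := by
  choose F hF using fun n => exists_rep (E n)
  exact ⟨F, funext fun n => (hF n).symm⟩

/-- The descent of the measure to the quotient. -/
def measure : NullQuot ν → ℝ :=
  Quotient.lift (fun E => ν.real (E : Set Ω)) (fun _ _ h => measureReal_congr (rel_iff.1 h))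

end NullQuot

/-- The probability algebra of the probability space `(Ω, ν)`: the σ-algebra modulo null sets. -/
def probAlgOf (ν : Measure Ω) [IsProbabilityMeasure ν] : ProbAlg.{u} where
  carrier := NullQuot ν
  exists_lub E := by
    obtain ⟨F, rfl⟩ := NullQuot.exists_reps E
    exact ⟨_, NullQuot.isLUB_mk F⟩
  exists_glb E := by
    obtain ⟨F, rfl⟩ := NullQuot.exists_reps E
    exact ⟨_, NullQuot.isGLB_mk F⟩
  μ := NullQuot.measure
  μ_mem a := by
    obtain ⟨E, rfl⟩ := NullQuot.exists_rep a
    exact ⟨measureReal_nonneg, measureReal_le_one⟩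
  μ_bot := by
    change ν.real (∅ : Set Ω) = 0
    simp
  μ_top := by
    change ν.real (Set.univ : Set Ω) = 1
    simp
  μ_hasSum E s hd hs := by
    obtain ⟨F, rfl⟩ := NullQuot.exists_reps E
    obtain rfl := hs.unique (NullQuot.isLUB_mk F)
    change HasSum (fun n => ν.real (F n : Set Ω)) (ν.real (⋃ n, (F n : Set Ω)))
    have hd' : Pairwise (Function.onFun (AEDisjoint ν) fun n => (F n : Set Ω)) := by
      intro m n hmn
      have h : (((F m ⊓ F n : Subtype (MeasurableSet : Set Ω → Prop))) : Set Ω) =ᵐ[ν] (∅ : Set Ω) :=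
        NullQuot.mk_eq.1 (hd hmn)
      exact ae_eq_empty.1 h
    have h1 := measure_iUnion₀ hd' (fun n => (F n).2.nullMeasurableSet)
    have h2 : ∑' n, ν (F n : Set Ω) ≠ ⊤ := by rw [← h1]; exact measure_ne_top _ _
    rw [measureReal_def, h1, ENNReal.tsum_toReal_eq (fun n => measure_ne_top _ _)]
    exact (ENNReal.summable_toReal h2).hasSum
  μ_pos a ha := by
    obtain ⟨E, rfl⟩ := NullQuot.exists_rep a
    change 0 < ν.real (E : Set Ω)
    refine lt_of_le_of_ne measureReal_nonneg fun h => ha ?_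
    have h0 : ν (E : Set Ω) = 0 := (measureReal_eq_zero_iff (measure_ne_top _ _)).1 h.symm
    exact NullQuot.mk_eq.2 (ae_eq_empty.2 h0)

/-- The morphism of probability algebras `[E] ↦ [S⁻¹(E)]` of a measure-preserving map `S`. -/
def probAlgMap {Ω' : Type v} [MeasurableSpace Ω'] {ν : Measure Ω} {ν' : Measure Ω'}
    [IsProbabilityMeasure ν] [IsProbabilityMeasure ν'] (S : Ω → Ω')
    (hS : MeasurePreserving S ν ν') : ProbAlg.Hom (probAlgOf ν) (probAlgOf ν') where
  pull :=
    { toFun := Quotient.map (fun E => ⟨S ⁻¹' E, hS.measurable E.2⟩) (fun _ _ h =>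
        NullQuot.rel_iff.2 (hS.quasiMeasurePreserving.preimage_ae_eq (NullQuot.rel_iff.1 h)))
      map_bot := rfl
      map_top := rfl
      map_sup := by
        intro a b
        obtain ⟨E, rfl⟩ := NullQuot.exists_rep a
        obtain ⟨F, rfl⟩ := NullQuot.exists_rep b
        rfl
      map_inf := by
        intro a b
        obtain ⟨E, rfl⟩ := NullQuot.exists_rep a
        obtain ⟨F, rfl⟩ := NullQuot.exists_rep b
        rfl
      map_compl := by
        intro a
        obtain ⟨E, rfl⟩ := NullQuot.exists_rep a
        rfl
      map_lub := by
        intro E s h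
        obtain ⟨F, rfl⟩ := NullQuot.exists_reps E
        obtain rfl := h.unique (NullQuot.isLUB_mk F)
        have h1 := NullQuot.isLUB_mk (ν := ν) fun n =>
          (⟨S ⁻¹' (F n), hS.measurable (F n).2⟩ : Subtype (MeasurableSet : Set Ω → Prop))
        have h2 : (⟨S ⁻¹' ⋃ n, (F n : Set Ω'), hS.measurable (MeasurableSet.iUnion fun n => (F n).2)⟩ :
            Subtype (MeasurableSet : Set Ω → Prop)) =
            ⟨⋃ n, S ⁻¹' (F n : Set Ω'), MeasurableSet.iUnion fun n => hS.measurable (F n).2⟩ :=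
          Subtype.ext Set.preimage_iUnion
        rw [← h2] at h1
        exact h1
      map_glb := by
        intro E s h
        obtain ⟨F, rfl⟩ := NullQuot.exists_reps E
        obtain rfl := h.unique (NullQuot.isGLB_mk F)
        have h1 := NullQuot.isGLB_mk (ν := ν) fun n =>
          (⟨S ⁻¹' (F n), hS.measurable (F n).2⟩ : Subtype (MeasurableSet : Set Ω → Prop))
        have h2 : (⟨S ⁻¹' ⋂ n, (F n : Set Ω'), hS.measurable (MeasurableSet.iInter fun n => (F n).2)⟩ :
            Subtype (MeasurableSet : Set Ω → Prop)) =
            ⟨⋂ n, S ⁻¹' (F n : Set Ω'), MeasurableSet.iInter fun n => hS.measurable (F n).2⟩ :=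
          Subtype.ext Set.preimage_iInter
        rw [← h2] at h1
        exact h1 }
  μ_pull a := by
    obtain ⟨E, rfl⟩ := NullQuot.exists_rep a
    exact hS.measureReal_preimage E.2.nullMeasurableSet

end Concrete

end

/-! A character of `L^∞(X)` takes only the values 0 and 1 on an indicator function, so each `E` in
`X` defines a clopen set `clopen E` of characters, and `E ↦ clopen E` is a Boolean homomorphism. The
link with general functions is `eval_mem_of_mem_clopen`: a character that sees `f` inside a closed
set `K` takes a value in `K` on `f`. It yields compactness, the fact that the sets `clopen E` form a
basis, and hence that they generate the Baire σ-algebra.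

The prime ideal theorem supplies enough characters: limits along an ultrafilter of `X` are
characters, so `clopen E` is nonempty for `E ≠ ⊥`, and `clopen` is injective. The measure of `X`
thus becomes a content on the clopen sets. By compactness it is countably subadditive, and
Carathéodory extension gives the model measure. Regularity comes from clopen covers of the
complement; the trace formula holds because evaluation at `f` pushes the measure to the law of `f`;
uniqueness follows by testing on indicators.

Finally, each Baire set agrees with a clopen set up to a null set (`exists_clopen_ae_eq`), so `X` is
the measure algebra of its model. Equivariance is the identity `map T ⁻¹' clopen E = clopen (T.pull
E)`. -/

noncomputable section

/-! ### σ-homomorphisms of Boolean algebras -/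

namespace SigmaHom

variable {A : Type*} {B : Type*} [BooleanAlgebra A] [BooleanAlgebra B]

theorem mono (φ : SigmaHom A B) {a b : A} (h : a ≤ b) : φ a ≤ φ b := by
  rw [← sup_eq_right] at h ⊢
  rw [← φ.map_sup, h]

/-- A Boolean homomorphism that preserves countable joins also preserves countable meets. -/
def ofLub (f : A → B) (hbot : f ⊥ = ⊥) (hsup : ∀ a b, f (a ⊔ b) = f a ⊔ f b)
    (hcompl : ∀ a, f aᶜ = (f a)ᶜ)
    (hlub : ∀ (E : ℕ → A) (s : A), IsLUB (Set.range E) s → IsLUB (Set.range (f ∘ E)) (f s)) :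
    SigmaHom A B where
  toFun := f
  map_bot := hbot
  map_top := by rw [← compl_bot, hcompl, hbot, compl_bot]
  map_sup := hsup
  map_inf a b := by
    rw [← compl_inj_iff, ← hcompl, compl_inf, compl_inf, hsup, hcompl, hcompl]
  map_compl := hcompl
  map_lub := hlub
  map_glb E s h := by
    have hc : IsLUB (Set.range fun n => (E n)ᶜ) sᶜ := by
      constructor
      · rintro _ ⟨n, rfl⟩
        exact compl_le_compl (h.1 ⟨n, rfl⟩)
      · intro u hu
        rw [← compl_compl u]
        refine compl_le_compl (h.2 ?_)
        rintro _ ⟨n, rfl⟩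
        exact compl_le_iff_compl_le.1 (hu ⟨n, rfl⟩)
    have h1 := hlub _ _ hc
    constructor
    · rintro _ ⟨n, rfl⟩
      have h2 := h1.1 ⟨n, rfl⟩
      simp only [Function.comp_apply, hcompl] at h2
      exact compl_le_compl_iff_le.1 h2
    · intro u hu
      rw [← compl_le_compl_iff_le, ← hcompl]
      refine h1.2 ?_
      rintro _ ⟨n, rfl⟩
      simp only [Function.comp_apply, hcompl]
      exact compl_le_compl (hu ⟨n, rfl⟩)

/-- An order isomorphism of Boolean algebras is a σ-homomorphism. -/
def ofOrderIso (e : A ≃o B) : SigmaHom A B :=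
  ofLub e e.map_bot e.map_sup (map_compl' e) (fun E s h => by
    rw [Set.range_comp]
    exact e.isLUB_image'.2 h)

end SigmaHom

/-! ### Gluing and composing abstractly measurable maps -/

namespace AbsMap

variable {A : Type*} [BooleanAlgebra A] {Ω : Type*} {Ω' : Type*} [MeasurableSpace Ω]
  [MeasurableSpace Ω']

/-- The abstractly measurable map that equals `f` on `E` and `g` on the complement of `E`. -/
def glue (E : A) (f g : AbsMap A Ω) : AbsMap A Ω :=
  SigmaHom.ofLub (fun B => (E ⊓ f B) ⊔ (Eᶜ ⊓ g B))
    (by simp [f.map_bot, g.map_bot])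
    (fun a b => by
      rw [f.map_sup, g.map_sup, inf_sup_left, inf_sup_left, sup_sup_sup_comm])
    (fun a => by
      rw [f.map_compl, g.map_compl]
      refine eq_compl_iff_isCompl.2 (IsCompl.of_eq ?_ ?_)
      · simp only [inf_sup_left, inf_sup_right]
        have h1 : E ⊓ (f a)ᶜ ⊓ (E ⊓ f a) = ⊥ := by
          rw [inf_inf_inf_comm]; simp
        have h2 : Eᶜ ⊓ (g a)ᶜ ⊓ (E ⊓ f a) = ⊥ := by
          rw [inf_inf_inf_comm]; simp
        have h3 : E ⊓ (f a)ᶜ ⊓ (Eᶜ ⊓ g a) = ⊥ := by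
          rw [inf_inf_inf_comm]; simp
        have h4 : Eᶜ ⊓ (g a)ᶜ ⊓ (Eᶜ ⊓ g a) = ⊥ := by
          rw [inf_inf_inf_comm]; simp
        simp [h1, h2, h3, h4]
      · rw [sup_sup_sup_comm, ← inf_sup_left, ← inf_sup_left, compl_sup_eq_top,
          compl_sup_eq_top, inf_top_eq, inf_top_eq, sup_compl_eq_top])
    (fun F s h => by
      have h1 := f.map_lub F s h
      have h2 := g.map_lub F s h
      constructor
      · rintro _ ⟨n, rfl⟩
        exact sup_le_sup (inf_le_inf_left _ (h1.1 ⟨n, rfl⟩)) (inf_le_inf_left _ (h2.1 ⟨n, rfl⟩))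
      · intro u hu
        refine sup_le ?_ ?_
        -- Meeting with a fixed element is left adjoint to the Heyting implication, so it preserves
        -- every existing join.
        · rw [inf_comm, ← le_himp_iff]
          refine h1.2 ?_
          rintro _ ⟨n, rfl⟩
          rw [le_himp_iff, inf_comm]
          exact le_sup_left.trans (hu ⟨n, rfl⟩)
        · rw [inf_comm, ← le_himp_iff]
          refine h2.2 ?_
          rintro _ ⟨n, rfl⟩
          rw [le_himp_iff, inf_comm]
          exact le_sup_right.trans (hu ⟨n, rfl⟩))

theorem glue_apply (E : A) (f g : AbsMap A Ω) (B : Subtype (MeasurableSet : Set Ω → Prop)) :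
    glue E f g B = (E ⊓ f B) ⊔ (Eᶜ ⊓ g B) := rfl

theorem post_apply (f : AbsMap A Ω) (g : Ω → Ω') (hg : Measurable g)
    (B : Subtype (MeasurableSet : Set Ω' → Prop)) :
    f.post g hg B = f ⟨g ⁻¹' B, hg B.2⟩ := rfl

theorem post_post {Ω'' : Type*} [MeasurableSpace Ω''] (f : AbsMap A Ω) (g : Ω → Ω')
    (hg : Measurable g) (k : Ω' → Ω'') (hk : Measurable k) :
    (f.post g hg).post k hk = f.post (k ∘ g) (hk.comp hg) := rfl

theorem glue_post (E : A) (f g : AbsMap A Ω) (k : Ω → Ω') (hk : Measurable k) :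
    (glue E f g).post k hk = glue E (f.post k hk) (g.post k hk) := rfl

theorem const_post (c : Ω) (k : Ω → Ω') (hk : Measurable k) :
    (const A c).post k hk = const A (k c) := rfl

theorem post_const (f : AbsMap A Ω) (c : Ω') :
    f.post (fun _ => c) measurable_const = const A c := by
  apply SigmaHom.ext
  funext B
  change f ⟨(fun _ => c) ⁻¹' B, _⟩ = _
  by_cases h : c ∈ (B : Set Ω')
  · have : (⟨(fun _ => c) ⁻¹' B, measurable_const B.2⟩ :
        Subtype (MeasurableSet : Set Ω → Prop)) = ⊤ := Subtype.ext (Set.preimage_const_of_mem h)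
    rw [this, f.map_top]
    exact (if_pos h).symm
  · have : (⟨(fun _ => c) ⁻¹' B, measurable_const B.2⟩ :
        Subtype (MeasurableSet : Set Ω → Prop)) = ⊥ := Subtype.ext (Set.preimage_const_of_notMem h)
    rw [this, f.map_bot]
    exact (if_neg h).symm

theorem glue_self (E : A) (f : AbsMap A Ω) : glue E f f = f := by
  apply SigmaHom.ext
  funext B
  change (E ⊓ f B) ⊔ (Eᶜ ⊓ f B) = f B
  rw [← inf_sup_right, sup_compl_eq_top, top_inf_eq]

theorem glue_top (f g : AbsMap A Ω) : glue ⊤ f g = f := by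
  apply SigmaHom.ext
  funext B
  change (⊤ ⊓ f B) ⊔ (⊤ᶜ ⊓ g B) = f B
  simp

theorem glue_compl (E : A) (f g : AbsMap A Ω) : glue Eᶜ f g = glue E g f := by
  apply SigmaHom.ext
  funext B
  change (Eᶜ ⊓ f B) ⊔ (Eᶜᶜ ⊓ g B) = (E ⊓ g B) ⊔ (Eᶜ ⊓ f B)
  rw [compl_compl, sup_comm]

theorem glue_inf (E F : A) (f g : AbsMap A Ω) : glue (E ⊓ F) f g = glue E (glue F f g) g := by
  apply SigmaHom.ext
  funext B
  change (E ⊓ F ⊓ f B) ⊔ ((E ⊓ F)ᶜ ⊓ g B) = (E ⊓ ((F ⊓ f B) ⊔ (Fᶜ ⊓ g B))) ⊔ (Eᶜ ⊓ g B)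
  rw [inf_sup_left, sup_assoc, ← inf_assoc, ← inf_assoc, ← inf_sup_right]
  congr 2
  rw [compl_inf, sup_comm (E ⊓ Fᶜ), sup_inf_left, sup_comm Eᶜ E, sup_compl_eq_top, top_inf_eq]

/-- With constant branches 1 and 0 this recognises a cut-off function of `f` as the indicator of `f
⟨K, hK⟩`. -/
theorem post_ite (f : AbsMap A Ω) (K : Set Ω) (hK : MeasurableSet K) (g k : Ω → Ω')
    (hg : Measurable g) (hk : Measurable k) [DecidablePred (· ∈ K)] :
    f.post (fun z => if z ∈ K then g z else k z) (Measurable.ite hK hg hk) =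
      glue (f ⟨K, hK⟩) (f.post g hg) (f.post k hk) := by
  apply SigmaHom.ext
  funext B
  change f ⟨_, _⟩ = (f ⟨K, hK⟩ ⊓ f ⟨_, _⟩) ⊔ ((f ⟨K, hK⟩)ᶜ ⊓ f ⟨_, _⟩)
  rw [← f.map_compl, ← f.map_inf, ← f.map_inf, ← f.map_sup]
  congr 1
  apply Subtype.ext
  ext z
  change (if z ∈ K then g z else k z) ∈ (B : Set Ω') ↔
    (z ∈ K ∧ g z ∈ (B : Set Ω')) ∨ (z ∉ K ∧ k z ∈ (B : Set Ω'))
  by_cases hz : z ∈ K <;> simp [hz]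

end AbsMap

/-! ### Finite additivity in probability algebras -/

namespace ProbAlg

variable (X : ProbAlg.{u})

theorem μ_sup {a b : X} (h : a ⊓ b = ⊥) : X.μ (a ⊔ b) = X.μ a + X.μ b := by
  classical
  -- Additivity is an axiom about sequences, so the pair is padded with `⊥`.
  let E : ℕ → X := fun n => if n = 0 then a else if n = 1 then b else ⊥
  have hE : ∀ n, n ∉ Finset.range 2 → X.μ (E n) = 0 := by
    intro n hn
    have h0 : n ≠ 0 := by rintro rfl; simp at hn
    have h1 : n ≠ 1 := by rintro rfl; simp at hn
    simp [E, h0, h1, X.μ_bot]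
  have hd : Pairwise (fun m n => E m ⊓ E n = ⊥) := by
    intro m n hmn
    have h' : b ⊓ a = ⊥ := by rw [inf_comm, h]
    dsimp only [E]
    split_ifs <;> simp_all
  have hs : IsLUB (Set.range E) (a ⊔ b) := by
    constructor
    · rintro _ ⟨n, rfl⟩
      dsimp only [E]
      split_ifs
      · exact le_sup_left
      · exact le_sup_right
      · exact bot_le
    · intro u hu
      exact sup_le (hu ⟨0, rfl⟩) (hu ⟨1, rfl⟩)
  have h1 := (X.μ_hasSum E _ hd hs).unique (hasSum_sum_of_ne_finset_zero hE)
  rw [h1, Finset.sum_range_succ, Finset.sum_range_one]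
  rfl

theorem μ_nonneg (a : X) : 0 ≤ X.μ a := (X.μ_mem a).1

theorem μ_mono {a b : X} (h : a ≤ b) : X.μ a ≤ X.μ b := by
  have h1 := X.μ_sup (inf_sdiff_self_right : a ⊓ b \ a = ⊥)
  rw [sup_sdiff_cancel_right h] at h1
  linarith [X.μ_nonneg (b \ a)]

theorem μ_eq_zero {a : X} (h : X.μ a = 0) : a = ⊥ := by
  by_contra ha
  exact (X.μ_pos a ha).ne' h

theorem μ_sup_le (a b : X) : X.μ (a ⊔ b) ≤ X.μ a + X.μ b := by
  have h1 := X.μ_sup (inf_sdiff_self_right : a ⊓ b \ a = ⊥)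
  rw [sup_sdiff_self_right] at h1
  linarith [X.μ_mono (sdiff_le : b \ a ≤ b)]

theorem μ_finset_sup_le {ι : Type*} (s : Finset ι) (E : ι → X) :
    X.μ (s.sup E) ≤ ∑ i ∈ s, X.μ (E i) := by
  classical
  induction s using Finset.induction_on with
  | empty => simp [X.μ_bot]
  | insert i s hi ih =>
    rw [Finset.sup_insert, Finset.sum_insert hi]
    linarith [X.μ_sup_le (E i) (s.sup E)]

end ProbAlg

/-! ### Indicator functions in `L^∞(X)` -/

namespace LInf

variable {X : ProbAlg.{u}}

/-- The composition of `f ∈ L^∞(X)` with a Borel function that is bounded on bounded sets. -/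
def post (f : LInf X) (h : ℂ → ℂ) (hh : Measurable h)
    (hb : ∀ M : ℝ, ∃ C : ℝ, ∀ z, ‖z‖ ≤ M → ‖h z‖ ≤ C) : LInf X :=
  ⟨f.val.post h hh, by
    obtain ⟨M, hM⟩ := f.bdd
    obtain ⟨C, hC⟩ := hb M
    refine ⟨C, top_le_iff.1 ?_⟩
    rw [← hM]
    refine f.val.mono (fun z hz => ?_)
    have hz' : ‖z‖ ≤ M := by simpa [disc] using hz
    change h z ∈ Metric.closedBall 0 C
    simpa using hC z hz'⟩

/-- The indicator function of `E`. -/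
def ind (E : X) : LInf X :=
  ⟨AbsMap.glue E (AbsMap.const X 1) (AbsMap.const X 0), 1, by
    rw [AbsMap.glue_apply]
    have h1 : AbsMap.const X (1 : ℂ) (disc 1) = ⊤ := if_pos (by simp [disc])
    have h0 : AbsMap.const X (0 : ℂ) (disc 1) = ⊤ := if_pos (by simp [disc])
    rw [h1, h0, inf_top_eq, inf_top_eq, sup_compl_eq_top]⟩

theorem ind_val (E : X) :
    (ind E).val = AbsMap.glue E (AbsMap.const X 1) (AbsMap.const X 0) := rfl

theorem ind_top : ind (⊤ : X) = const X 1 := LInf.ext (AbsMap.glue_top _ _)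

theorem isProd_ind (E F : X) : IsProd (ind E) (ind F) (ind (E ⊓ F)) := by
  -- The joint map takes four constant values on the four pieces cut out by `E` and `F`.
  refine ⟨AbsMap.glue E (AbsMap.glue F (AbsMap.const X (1, 1)) (AbsMap.const X (1, 0)))
    (AbsMap.glue F (AbsMap.const X (0, 1)) (AbsMap.const X (0, 0))), ?_, ?_, ?_⟩
  · simp only [AbsMap.glue_post, AbsMap.const_post, AbsMap.glue_self, ind_val]
  · simp only [AbsMap.glue_post, AbsMap.const_post, AbsMap.glue_self, ind_val]
  · simp only [AbsMap.glue_post, AbsMap.const_post, AbsMap.glue_inf, ind_val, AbsMap.glue_self,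
      mul_one, mul_zero]

theorem isSum_ind_compl (E : X) : IsSum (ind E) (ind Eᶜ) (const X 1) := by
  refine ⟨AbsMap.glue E (AbsMap.const X (1, 0)) (AbsMap.const X (0, 1)), ?_, ?_, ?_⟩
  · simp only [AbsMap.glue_post, AbsMap.const_post, ind_val]
  · simp only [AbsMap.glue_post, AbsMap.const_post, ind_val, AbsMap.glue_compl]
  · simp only [AbsMap.glue_post, AbsMap.const_post, zero_add, add_zero, AbsMap.glue_self]
    rfl

theorem koopman_ind {Y : ProbAlg.{v}} (T : ProbAlg.Hom X Y) (E : Y) :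
    (ind E).koopman T = ind (T.pull E) := by
  apply LInf.ext
  apply SigmaHom.ext
  funext B
  change T.pull ((E ⊓ AbsMap.const Y 1 B) ⊔ (Eᶜ ⊓ AbsMap.const Y 0 B)) =
    (T.pull E ⊓ AbsMap.const X 1 B) ⊔ ((T.pull E)ᶜ ⊓ AbsMap.const X 0 B)
  have h (c : ℂ) : T.pull (AbsMap.const Y c B) = AbsMap.const X c B := by
    by_cases hc : c ∈ (B : Set ℂ)
    · simp [AbsMap.const, hc, T.pull.map_top]
    · simp [AbsMap.const, hc, T.pull.map_bot]
  rw [T.pull.map_sup, T.pull.map_inf, T.pull.map_inf, T.pull.map_compl, h, h]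

end LInf

/-! ### Topology and Baire σ-algebra of the spectrum -/

namespace Stone

variable {X : ProbAlg.{u}} {Y : ProbAlg.{v}}

theorem continuous_eval (f : LInf X) : Continuous fun x : Stone X => x.toFun f :=
  (continuous_apply f).comp continuous_induced_dom

/-- Indicators are idempotent, and ℂ has only the idempotents 0 and 1. -/
theorem eval_ind (x : Stone X) (E : X) : x.toFun (LInf.ind E) = 0 ∨ x.toFun (LInf.ind E) = 1 := by
  have h := x.map_prod _ _ _ (LInf.isProd_ind E E)
  rw [inf_idem] at h
  have h' : x.toFun (LInf.ind E) * (x.toFun (LInf.ind E) - 1) = 0 := by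
    rw [mul_sub, mul_one, ← h, sub_self]
  exact (mul_eq_zero.1 h').imp_right sub_eq_zero.1

/-- The clopen set of characters that take the value `1` on the indicator function of `E`. -/
def clopen (E : X) : Set (Stone X) := {x | x.toFun (LInf.ind E) = 1}

theorem mem_clopen {E : X} {x : Stone X} : x ∈ clopen E ↔ x.toFun (LInf.ind E) = 1 := Iff.rfl

theorem clopen_inf (E F : X) : clopen (E ⊓ F) = clopen E ∩ clopen F := by
  ext x
  rw [Set.mem_inter_iff, mem_clopen, mem_clopen, mem_clopen,
    x.map_prod _ _ _ (LInf.isProd_ind E F)]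
  rcases eval_ind x E with h | h <;> rcases eval_ind x F with h' | h' <;> simp [h, h']

theorem clopen_compl (E : X) : clopen Eᶜ = (clopen E)ᶜ := by
  ext x
  have h := x.map_sum _ _ _ (LInf.isSum_ind_compl E)
  rw [x.map_const] at h
  rw [Set.mem_compl_iff, mem_clopen, mem_clopen]
  rcases eval_ind x E with h' | h'
  · rw [h', zero_add] at h
    simp [h', ← h]
  · rw [h', left_eq_add] at h
    simp [h', h]

theorem clopen_top : clopen (⊤ : X) = Set.univ := by
  ext x
  simp [mem_clopen, LInf.ind_top, x.map_const]

theorem clopen_bot : clopen (⊥ : X) = ∅ := by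
  rw [← compl_top, clopen_compl, clopen_top, Set.compl_univ]

theorem clopen_sup (E F : X) : clopen (E ⊔ F) = clopen E ∪ clopen F := by
  rw [← compl_compl (E ⊔ F), compl_sup, clopen_compl, clopen_inf, clopen_compl, clopen_compl,
    Set.compl_inter, compl_compl, compl_compl]

theorem clopen_sdiff (E F : X) : clopen (E \ F) = clopen E \ clopen F := by
  rw [sdiff_eq, clopen_inf, clopen_compl, Set.sdiff_eq]

theorem clopen_mono {E F : X} (h : E ≤ F) : clopen E ⊆ clopen F := by
  rw [← inf_eq_left.2 h, clopen_inf]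
  exact Set.inter_subset_right

theorem clopen_finset_sup {ι : Type*} (s : Finset ι) (E : ι → X) :
    clopen (s.sup E) = ⋃ i ∈ s, clopen (E i) := by
  classical
  induction s using Finset.induction_on with
  | empty => simp [clopen_bot]
  | insert i s hi ih => rw [Finset.sup_insert, clopen_sup, ih, Finset.set_biUnion_insert]

theorem isClosed_clopen (E : X) : IsClosed (clopen E) :=
  isClosed_eq (continuous_eval _) continuous_const

theorem isOpen_clopen (E : X) : IsOpen (clopen E) := by
  rw [← compl_compl (clopen E), ← clopen_compl]
  exact (isClosed_clopen _).isOpen_compl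

theorem map_preimage_clopen (T : ProbAlg.Hom X Y) (E : Y) :
    map T ⁻¹' clopen E = clopen (T.pull E) := by
  ext x
  change x.toFun ((LInf.ind E).koopman T) = 1 ↔ _
  rw [LInf.koopman_ind]
  rfl

/-- If `f` takes its values in the closed set `K` on `E`, then so does the Gelfand transform of `f`
on the clopen set of `E`. -/
theorem eval_mem_of_mem_clopen (f : LInf X) {K : Set ℂ} (hK : IsClosed K) {x : Stone X}
    (hx : x ∈ clopen (f.val ⟨K, hK.measurableSet⟩)) : x.toFun f ∈ K := by
  classical
  by_contra hc
  set c := x.toFun f with hc_def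
  obtain ⟨δ, hδ, hball⟩ := Metric.isOpen_iff.1 hK.isOpen_compl c hc
  have hfar : ∀ z ∈ K, δ ≤ ‖z - c‖ := by
    intro z hz
    by_contra hlt
    exact hball (by rwa [Metric.mem_ball, dist_eq_norm, ← not_le]) hz
  have hm1 : Measurable fun z : ℂ => z - c := measurable_id.sub_const c
  have hm2 : Measurable fun z : ℂ => if z ∈ K then (z - c)⁻¹ else 0 :=
    Measurable.ite hK.measurableSet hm1.inv measurable_const
  let f₁ : LInf X := f.post (fun z => z - c) hm1
    (fun M => ⟨M + ‖c‖, fun z hz => (norm_sub_le z c).trans (by linarith)⟩)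
  -- The inverse of `z - c` cut off outside `K` is bounded by `δ⁻¹`, as `K` has distance at least
  -- `δ` from `c`.
  let g : LInf X := f.post (fun z => if z ∈ K then (z - c)⁻¹ else 0) hm2 (fun _ => ⟨δ⁻¹, by
    intro z _
    split_ifs with hz
    · rw [norm_inv]
      exact inv_anti₀ hδ (hfar z hz)
    · rw [norm_zero]
      positivity⟩)
  have h1 : x.toFun f = x.toFun f₁ + x.toFun (LInf.const X c) := by
    refine x.map_sum _ _ _ ⟨f.val.post (fun z => (z - c, c)) (hm1.prodMk measurable_const), rfl,
      AbsMap.post_const _ _, ?_⟩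
    rw [AbsMap.post_post]
    have : ((fun z : ℂ × ℂ => z.1 + z.2) ∘ fun z : ℂ => (z - c, c)) = fun z => z := by
      funext z
      simp
    simp only [this]
    rfl
  rw [x.map_const, ← hc_def, right_eq_add] at h1
  -- The product of `f - c` and `g` is the indicator of `f ∈ K`. The character gives 1 on this
  -- indicator but 0 on `f - c`, a contradiction.
  have h2 : x.toFun (LInf.ind (f.val ⟨K, hK.measurableSet⟩)) = x.toFun f₁ * x.toFun g := by
    refine x.map_prod _ _ _ ⟨f.val.post (fun z => (z - c, if z ∈ K then (z - c)⁻¹ else 0))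
      (hm1.prodMk hm2), rfl, rfl, ?_⟩
    rw [AbsMap.post_post, LInf.ind_val, ← AbsMap.post_const f.val (1 : ℂ),
      ← AbsMap.post_const f.val (0 : ℂ), ← AbsMap.post_ite]
    have : ((fun z : ℂ × ℂ => z.1 * z.2) ∘ fun z : ℂ =>
        (z - c, if z ∈ K then (z - c)⁻¹ else 0)) = fun z => if z ∈ K then 1 else 0 := by
      funext z
      by_cases hz : z ∈ K
      · have : z - c ≠ 0 := norm_pos_iff.1 (hδ.trans_le (hfar z hz))
        simp [hz, this]
      · simp [hz]
    simp only [this]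
  rw [mem_clopen.1 hx, h1, zero_mul] at h2
  exact one_ne_zero h2

/-- The characters form a closed subset of a product of discs: the relations are closed conditions,
and `|x(f)| ≤ M` is `eval_mem_of_mem_clopen` for a disc whose preimage under `f` is `⊤`. -/
instance : CompactSpace (Stone X) := by
  choose M hM using fun f : LInf X => f.bdd
  have hemb : Topology.IsInducing (Stone.toFun : Stone X → LInf X → ℂ) := ⟨rfl⟩
  have hrange : Set.range (Stone.toFun : Stone X → LInf X → ℂ) =
      {φ | (∀ f g h, LInf.IsSum f g h → φ h = φ f + φ g) ∧
        (∀ f g h, LInf.IsProd f g h → φ h = φ f * φ g) ∧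
        (∀ f : LInf X, φ f.conj = star (φ f)) ∧ ∀ c, φ (LInf.const X c) = c} := by
    ext φ
    constructor
    · rintro ⟨x, rfl⟩
      exact ⟨x.map_sum, x.map_prod, x.map_conj, x.map_const⟩
    · rintro ⟨h1, h2, h3, h4⟩
      exact ⟨⟨φ, h1, h2, h3, h4⟩, rfl⟩
  have hclosed : IsClosed (Set.range (Stone.toFun : Stone X → LInf X → ℂ)) := by
    rw [hrange]
    simp only [Set.ofPred_and, Set.ofPred_forall]
    refine IsClosed.inter ?_ (IsClosed.inter ?_ (IsClosed.inter ?_ ?_))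
    · exact isClosed_iInter fun f => isClosed_iInter fun g => isClosed_iInter fun h =>
        isClosed_iInter fun _ => isClosed_eq (continuous_apply h)
          ((continuous_apply f).add (continuous_apply g))
    · exact isClosed_iInter fun f => isClosed_iInter fun g => isClosed_iInter fun h =>
        isClosed_iInter fun _ => isClosed_eq (continuous_apply h)
          ((continuous_apply f).mul (continuous_apply g))
    · exact isClosed_iInter fun f => isClosed_eq (continuous_apply _)
        (continuous_star.comp (continuous_apply f))
    · exact isClosed_iInter fun c => isClosed_eq (continuous_apply _) continuous_const
  have hsub : Set.range (Stone.toFun : Stone X → LInf X → ℂ) ⊆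
      Set.univ.pi fun f => Metric.closedBall 0 (M f) := by
    rintro _ ⟨x, rfl⟩ f -
    refine eval_mem_of_mem_clopen f Metric.isClosed_closedBall ?_
    have h : f.val ⟨Metric.closedBall 0 (M f), _⟩ = ⊤ := hM f
    rw [h, clopen_top]
    trivial
  have hcomp : IsCompact (Set.range (Stone.toFun : Stone X → LInf X → ℂ)) :=
    (isCompact_univ_pi fun f => isCompact_closedBall 0 (M f)).of_isClosed_subset hclosed hsub
  rw [← Set.image_univ] at hcomp
  exact ⟨hemb.isCompact_iff.2 hcomp⟩

instance : T2Space (Stone X) :=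
  T2Space.of_injective_continuous (f := Stone.toFun) (fun _ _ h => Stone.ext h)
    continuous_induced_dom

theorem isTopologicalBasis_clopen :
    TopologicalSpace.IsTopologicalBasis (Set.range (clopen : X → Set (Stone X))) := by
  refine TopologicalSpace.isTopologicalBasis_of_isOpen_of_nhds ?_ ?_
  · rintro _ ⟨E, rfl⟩
    exact isOpen_clopen E
  · intro x V hx hV
    have hV' : V ∈ Filter.comap Stone.toFun (nhds x.toFun) := by
      rw [← nhds_induced]
      exact hV.mem_nhds hx
    rw [nhds_pi, Filter.pi, Filter.comap_iInf] at hV'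
    -- A neighbourhood restricts finitely many coordinates; these are handled one by one, by
    -- induction along the infimum of filters.
    have hind : ∀ S : Set (Stone X), S ∈ (⨅ f : LInf X,
        Filter.comap Stone.toFun (Filter.comap (Function.eval f) (nhds (x.toFun f)))) →
        ∃ E, x ∈ clopen E ∧ clopen E ⊆ S := by
      intro S hS
      refine Filter.iInf_sets_induct hS ⟨⊤, by rw [clopen_top]; trivial, Set.subset_univ _⟩ ?_
      rintro f S₁ S₂ hS₁ ⟨E, hxE, hES⟩
      rw [Filter.comap_comap] at hS₁
      obtain ⟨W, hW, hWS⟩ := hS₁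
      obtain ⟨ε, hε, hεW⟩ := Metric.nhds_basis_closedBall.mem_iff.1 hW
      let K : Set ℂ := Metric.closedBall (x.toFun f) ε
      have hK : IsClosed K := Metric.isClosed_closedBall
      have hL : IsClosed (Metric.ball (x.toFun f) ε)ᶜ := Metric.isOpen_ball.isClosed_compl
      refine ⟨f.val ⟨K, hK.measurableSet⟩ ⊓ E, ?_, ?_⟩
      · rw [clopen_inf]
        refine ⟨?_, hxE⟩
        -- `x` cannot see `f` at distance at least `ε` from its own value, so it must see `f` inside
        -- the closed ball `K`.
        have hnot : x ∉ clopen (f.val ⟨_, hL.measurableSet⟩) := fun h =>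
          eval_mem_of_mem_clopen f hL h (Metric.mem_ball_self hε)
        by_contra hxK
        rw [← Set.mem_compl_iff, ← clopen_compl, ← f.val.map_compl] at hxK
        refine hnot (clopen_mono (f.val.mono ?_) hxK)
        exact Set.compl_subset_compl.2 Metric.ball_subset_closedBall
      · rw [clopen_inf]
        exact Set.inter_subset_inter
          (fun y hy => hWS (hεW (eval_mem_of_mem_clopen f hK hy))) hES
    obtain ⟨E, hE, hES⟩ := hind V hV'
    exact ⟨_, ⟨E, rfl⟩, hE, hES⟩

theorem exists_clopen_between {K V : Set (Stone X)} (hK : IsCompact K) (hV : IsOpen V)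
    (hKV : K ⊆ V) : ∃ E, K ⊆ clopen E ∧ clopen E ⊆ V := by
  refine hK.induction_on (p := fun S => ∃ E, S ⊆ clopen E ∧ clopen E ⊆ V)
    ⟨⊥, Set.empty_subset _, by rw [clopen_bot]; exact Set.empty_subset _⟩ ?_ ?_ ?_
  · rintro S S' h ⟨E, h1, h2⟩
    exact ⟨E, h.trans h1, h2⟩
  · rintro S S' ⟨E, h1, h2⟩ ⟨E', h1', h2'⟩
    exact ⟨E ⊔ E', by rw [clopen_sup]; exact Set.union_subset_union h1 h1',
      by rw [clopen_sup]; exact Set.union_subset h2 h2'⟩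
  · intro x hx
    obtain ⟨_, ⟨E, rfl⟩, hxE, hEV⟩ :=
      isTopologicalBasis_clopen.exists_subset_of_mem_open (hKV hx) hV
    exact ⟨_, mem_nhdsWithin_of_mem_nhds ((isOpen_clopen E).mem_nhds hxE), E, subset_rfl, hEV⟩

theorem measurableSet_clopen (E : X) : MeasurableSet (clopen E) := by
  have h : MeasurableSpace.comap (fun x : Stone X => x.toFun (LInf.ind E)) (borel ℂ) ≤
      baire (Stone X) :=
    le_iSup (fun f : C(Stone X, ℂ) => MeasurableSpace.comap f (borel ℂ))
      ⟨_, continuous_eval (LInf.ind E)⟩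
  exact h _ ⟨{1}, by rw [← BorelSpace.measurable_eq]; exact measurableSet_singleton 1, rfl⟩

theorem measurable_of_continuous {g : Stone X → ℂ} (hg : Continuous g) : Measurable g := by
  rw [BorelSpace.measurable_eq (α := ℂ), measurable_iff_comap_le]
  exact le_iSup (fun f : C(Stone X, ℂ) => MeasurableSpace.comap f (borel ℂ)) ⟨g, hg⟩

theorem measurable_eval (f : LInf X) : Measurable fun x : Stone X => x.toFun f :=
  measurable_of_continuous (continuous_eval f)

/-- An open `V ⊆ ℂ` is a countable union of closed sets. Their preimages under a continuous function
are compact, so a clopen set fits between each of them and the preimage of `V`, which is therefore a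
countable union of clopen sets. -/
theorem baire_eq_generateFrom :
    (inferInstance : MeasurableSpace (Stone X)) =
      MeasurableSpace.generateFrom (Set.range (clopen : X → Set (Stone X))) := by
  refine le_antisymm (iSup_le fun g => ?_) ?_
  · rw [borel, MeasurableSpace.comap_generateFrom]
    refine MeasurableSpace.generateFrom_le ?_
    rintro _ ⟨V, hV, rfl⟩
    obtain ⟨F, hF, hFV, hUnion, -⟩ := IsOpen.exists_iUnion_isClosed (show IsOpen V from hV)
    choose E hE hE' using fun n => exists_clopen_between
      ((hF n).preimage g.continuous).isCompact (hV.preimage g.continuous)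
      (Set.preimage_mono (hFV n))
    have h : g ⁻¹' V = ⋃ n, clopen (E n) := by
      refine Set.Subset.antisymm ?_ (Set.iUnion_subset hE')
      conv_lhs => rw [← hUnion, Set.preimage_iUnion]
      exact Set.iUnion_mono hE
    rw [h]
    exact MeasurableSet.iUnion fun n => MeasurableSpace.measurableSet_generateFrom ⟨E n, rfl⟩
  · refine MeasurableSpace.generateFrom_le ?_
    rintro _ ⟨E, rfl⟩
    exact measurableSet_clopen E

theorem isPiSystem_clopen : IsPiSystem (Set.range (clopen : X → Set (Stone X))) := by
  rintro _ ⟨E, rfl⟩ _ ⟨F, rfl⟩ -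
  exact ⟨E ⊓ F, clopen_inf E F⟩

end Stone

/-! ### Limits along ultrafilters -/

namespace AbsMap

variable {A : Type*} [BooleanAlgebra A] {Ω : Type*} {Ω' : Type*} [MeasurableSpace Ω]
  [MeasurableSpace Ω'] [TopologicalSpace Ω] [TopologicalSpace Ω'] [OpensMeasurableSpace Ω]
  [OpensMeasurableSpace Ω']

/-- `f` converges to `c` along the ultrafilter complementary to the ideal `J`. -/
def ConvergesAlong (J : Order.Ideal A) (f : AbsMap A Ω) (c : Ω) : Prop :=
  ∀ (V : Set Ω) (hV : IsOpen V), c ∈ V → f ⟨V, hV.measurableSet⟩ ∉ J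

/-- Disjoint neighbourhoods pull back to elements with meet `⊥ ∈ J`, and primality puts one of them
in `J`. -/
theorem ConvergesAlong.unique {J : Order.Ideal A} (hJ : J.IsPrime) [T2Space Ω] {f : AbsMap A Ω}
    {c d : Ω} (hc : ConvergesAlong J f c) (hd : ConvergesAlong J f d) : c = d := by
  by_contra hne
  obtain ⟨V, W, hV, hW, hcV, hdW, hVW⟩ := t2_separation hne
  have h : f ⟨V, hV.measurableSet⟩ ⊓ f ⟨W, hW.measurableSet⟩ ∈ J := by
    rw [← f.map_inf]
    have : (⟨V, hV.measurableSet⟩ ⊓ ⟨W, hW.measurableSet⟩ :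
        Subtype (MeasurableSet : Set Ω → Prop)) = ⊥ :=
      Subtype.ext (Set.disjoint_iff_inter_eq_empty.1 hVW)
    rw [this, f.map_bot]
    exact J.bot_mem
  exact (hJ.mem_or_mem h).elim (hc V hV hcV) (hd W hW hdW)

theorem ConvergesAlong.post {J : Order.Ideal A} {f : AbsMap A Ω} {c : Ω}
    (hc : ConvergesAlong J f c) {g : Ω → Ω'} (hg : Continuous g) (hgm : Measurable g) :
    ConvergesAlong J (f.post g hgm) (g c) :=
  fun V hV hcV => hc (g ⁻¹' V) (hV.preimage hg) hcV

theorem convergesAlong_const {J : Order.Ideal A} (hJ : J.IsPrime) (c : Ω) :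
    ConvergesAlong J (const A c) c := by
  intro V hV hcV h
  have : const A c ⟨V, hV.measurableSet⟩ = ⊤ := if_pos hcV
  rw [this] at h
  exact hJ.toIsProper.top_notMem h

/-- Sums and products in `L^∞(X)` are defined through a joint map; its convergence to the pair of
limits makes the limit additive and multiplicative. -/
theorem convergesAlong_prod {J : Order.Ideal A} (hJ : J.IsPrime)
    [OpensMeasurableSpace (Ω × Ω')] {P : AbsMap A (Ω × Ω')} {a : Ω} {b : Ω'}
    (ha : ConvergesAlong J (P.post Prod.fst measurable_fst) a)
    (hb : ConvergesAlong J (P.post Prod.snd measurable_snd) b) : ConvergesAlong J P (a, b) := by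
  intro V hV hab h
  obtain ⟨S, T, hS, hT, haS, hbT, hST⟩ := isOpen_prod_iff.1 hV a b hab
  have h' : P.post Prod.fst measurable_fst ⟨S, hS.measurableSet⟩ ⊓
      P.post Prod.snd measurable_snd ⟨T, hT.measurableSet⟩ ∈ J := by
    rw [post_apply, post_apply, ← P.map_inf]
    exact J.lower (P.mono hST) h
  exact (hJ.mem_or_mem h').elim (ha S hS haS) (hb T hT hbT)

/-- If no point were a limit, each point of `K` would have a neighbourhood pulled back into `J`;
finitely many cover `K`, which would force `⊤ ∈ J`. -/
theorem exists_convergesAlong {J : Order.Ideal A} (hJ : J.IsPrime) {f : AbsMap A Ω} {K : Set Ω}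
    (hK : IsCompact K) (hKm : MeasurableSet K) (hf : f ⟨K, hKm⟩ = ⊤) :
    ∃ c, ConvergesAlong J f c := by
  by_contra! hcon
  have hcov : ∃ V : Set Ω, ∃ hV : IsOpen V, K ⊆ V ∧ f ⟨V, hV.measurableSet⟩ ∈ J := by
    refine hK.induction_on (p := fun S => ∃ V : Set Ω, ∃ hV : IsOpen V, S ⊆ V ∧
      f ⟨V, hV.measurableSet⟩ ∈ J) ⟨∅, isOpen_empty, subset_rfl, ?_⟩ ?_ ?_ ?_
    · have : f ⟨∅, MeasurableSet.empty⟩ = ⊥ := f.map_bot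
      rw [this]
      exact J.bot_mem
    · rintro S S' hS ⟨V, hV, h1, h2⟩
      exact ⟨V, hV, hS.trans h1, h2⟩
    · rintro S S' ⟨V, hV, h1, h2⟩ ⟨V', hV', h1', h2'⟩
      refine ⟨V ∪ V', hV.union hV', Set.union_subset_union h1 h1', ?_⟩
      have := f.map_sup ⟨V, hV.measurableSet⟩ ⟨V', hV'.measurableSet⟩
      change f ⟨V ∪ V', _⟩ = _ at this
      rw [this]
      exact J.sup_mem h2 h2'
    · intro c _
      have h := hcon c
      simp only [ConvergesAlong, not_forall, not_not] at h
      obtain ⟨V, hV, hcV, hVJ⟩ := h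
      exact ⟨V, mem_nhdsWithin_of_mem_nhds (hV.mem_nhds hcV), V, hV, subset_rfl, hVJ⟩
  obtain ⟨V, hV, hKV, hVJ⟩ := hcov
  refine hJ.toIsProper.top_notMem ?_
  rw [← hf]
  exact J.lower (f.mono hKV) hVJ

end AbsMap

/-! ### Characters from prime ideals -/

namespace Stone

variable {X : ProbAlg.{u}}

theorem exists_limit {J : Order.Ideal X} (hJ : J.IsPrime) (f : LInf X) :
    ∃ c, AbsMap.ConvergesAlong J f.val c := by
  obtain ⟨M, hM⟩ := f.bdd
  exact AbsMap.exists_convergesAlong hJ (isCompact_closedBall 0 M) measurableSet_closedBall hM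

/-- The limit of `f` along the ultrafilter complementary to `J`. -/
def limit {J : Order.Ideal X} (hJ : J.IsPrime) (f : LInf X) : ℂ := (exists_limit hJ f).choose

theorem convergesAlong_limit {J : Order.Ideal X} (hJ : J.IsPrime) (f : LInf X) :
    AbsMap.ConvergesAlong J f.val (limit hJ f) := (exists_limit hJ f).choose_spec

theorem limit_eq {J : Order.Ideal X} (hJ : J.IsPrime) {f : LInf X} {c : ℂ}
    (h : AbsMap.ConvergesAlong J f.val c) : limit hJ f = c :=
  AbsMap.ConvergesAlong.unique hJ (convergesAlong_limit hJ f) h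

/-- The character of `L^∞(X)` given by the limit along the ultrafilter complementary to `J`. -/
def ofPrime (J : Order.Ideal X) (hJ : J.IsPrime) : Stone X where
  toFun f := limit hJ f
  map_sum f g h := by
    rintro ⟨P, h1, h2, h3⟩
    refine limit_eq hJ ?_
    rw [← h3]
    refine (AbsMap.convergesAlong_prod hJ (a := limit hJ f) (b := limit hJ g) ?_ ?_).post
      continuous_add (measurable_fst.add measurable_snd)
    · exact h1 ▸ convergesAlong_limit hJ f
    · exact h2 ▸ convergesAlong_limit hJ g
  map_prod f g h := by
    rintro ⟨P, h1, h2, h3⟩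
    refine limit_eq hJ ?_
    rw [← h3]
    refine (AbsMap.convergesAlong_prod hJ (a := limit hJ f) (b := limit hJ g) ?_ ?_).post
      continuous_mul (measurable_fst.mul measurable_snd)
    · exact h1 ▸ convergesAlong_limit hJ f
    · exact h2 ▸ convergesAlong_limit hJ g
  map_conj f := limit_eq hJ
    ((convergesAlong_limit hJ f).post continuous_star continuous_star.measurable)
  map_const c := limit_eq hJ (AbsMap.convergesAlong_const hJ c)

/-- Some prime ideal omits `E`. Along it the indicator of `E` tends to 1, since every neighbourhood
of 1 pulls back to an element above `E`. -/
theorem clopen_nonempty {E : X} (hE : E ≠ ⊥) : (clopen E).Nonempty := by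
  have hdisj : Disjoint (Order.PFilter.principal E : Set X) (⊥ : Order.Ideal X) := by
    rw [Set.disjoint_left]
    intro a ha ha'
    have h1 : E ≤ a := ha
    have h2 : a ≤ ⊥ := ha'
    exact hE (le_bot_iff.1 (h1.trans h2))
  obtain ⟨J, hJ, -, hJE⟩ := DistribLattice.prime_ideal_of_disjoint_filter_ideal hdisj
  have hEJ : E ∉ J := Set.disjoint_left.1 hJE (le_refl E)
  refine ⟨ofPrime J hJ, ?_⟩
  refine limit_eq hJ ?_
  intro V hV h1 hmem
  refine hEJ (J.lower ?_ hmem)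
  rw [LInf.ind_val, AbsMap.glue_apply]
  have : AbsMap.const X (1 : ℂ) ⟨V, hV.measurableSet⟩ = ⊤ := if_pos h1
  rw [this, inf_top_eq]
  exact le_sup_left

theorem clopen_le_iff {E F : X} : clopen E ⊆ clopen F ↔ E ≤ F := by
  refine ⟨fun h => ?_, clopen_mono⟩
  by_contra hEF
  have hne : E \ F ≠ ⊥ := fun h' => hEF (sdiff_eq_bot_iff.1 h')
  obtain ⟨x, hx⟩ := clopen_nonempty hne
  rw [clopen_sdiff] at hx
  exact hx.2 (h hx.1)

theorem clopen_injective : Function.Injective (clopen : X → Set (Stone X)) := fun _ _ h =>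
  le_antisymm (clopen_le_iff.1 h.le) (clopen_le_iff.1 h.ge)

/-! ### The model measure and its regularity -/

theorem isSetRing_clopen : IsSetRing (Set.range (clopen : X → Set (Stone X))) where
  empty_mem := ⟨⊥, clopen_bot⟩
  union_mem := by
    rintro _ _ ⟨E, rfl⟩ ⟨F, rfl⟩
    exact ⟨E ⊔ F, clopen_sup E F⟩
  sdiff_mem := by
    rintro _ _ ⟨E, rfl⟩ ⟨F, rfl⟩
    exact ⟨E \ F, clopen_sdiff E F⟩

theorem invFun_clopen (E : X) : Function.invFun clopen (clopen E) = E :=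
  Function.leftInverse_invFun clopen_injective E

/-- The finitely additive content on the clopen algebra that corresponds to the measure of `X`. -/
def content (X : ProbAlg.{u}) : AddContent ENNReal (Set.range (clopen : X → Set (Stone X))) :=
  isSetRing_clopen.addContent_of_union
    (fun S => ENNReal.ofReal (X.μ (Function.invFun clopen S)))
    (by
      have h := invFun_clopen (⊥ : X)
      rw [clopen_bot] at h
      rw [h, X.μ_bot, ENNReal.ofReal_zero])
    (by
      rintro _ _ ⟨E, rfl⟩ ⟨F, rfl⟩ hd
      have h : E ⊓ F = ⊥ := clopen_injective (by
        rw [clopen_inf, clopen_bot, Set.disjoint_iff_inter_eq_empty.1 hd])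
      rw [← clopen_sup, invFun_clopen, invFun_clopen, invFun_clopen, X.μ_sup h,
        ENNReal.ofReal_add (X.μ_nonneg E) (X.μ_nonneg F)])

theorem content_clopen (E : X) : content X (clopen E) = ENNReal.ofReal (X.μ E) := by
  change ENNReal.ofReal (X.μ (Function.invFun clopen (clopen E))) = _
  rw [invFun_clopen]

/-- A clopen set covered by countably many clopen sets is covered by finitely many of them, so
finite subadditivity of `X.μ` suffices. -/
theorem isSigmaSubadditive_content : (content X).IsSigmaSubadditive := by
  intro f hf hU
  choose E hE using hf
  obtain rfl : f = fun n => clopen (E n) := funext fun n => (hE n).symm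
  obtain ⟨F, hF⟩ := hU
  obtain ⟨t, ht⟩ := (isClosed_clopen F).isCompact.elim_finite_subcover (fun n => clopen (E n))
    (fun n => isOpen_clopen (E n)) hF.le
  rw [← clopen_finset_sup, clopen_le_iff] at ht
  rw [← hF, content_clopen]
  calc ENNReal.ofReal (X.μ F) ≤ ENNReal.ofReal (∑ n ∈ t, X.μ (E n)) :=
        ENNReal.ofReal_le_ofReal ((X.μ_mono ht).trans (X.μ_finset_sup_le t E))
    _ = ∑ n ∈ t, content X (clopen (E n)) := by
        rw [ENNReal.ofReal_sum_of_nonneg fun n _ => X.μ_nonneg (E n)]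
        exact Finset.sum_congr rfl fun n _ => (content_clopen (E n)).symm
    _ ≤ ∑' n, content X (clopen (E n)) := ENNReal.sum_le_tsum t

/-- The measure of the canonical model. -/
def modelMeasure (X : ProbAlg.{u}) : Measure (Stone X) :=
  (content X).measure isSetRing_clopen.isSetSemiring baire_eq_generateFrom.le
    isSigmaSubadditive_content

theorem modelMeasure_clopen (E : X) : modelMeasure X (clopen E) = ENNReal.ofReal (X.μ E) :=
  ((content X).measure_eq isSetRing_clopen.isSetSemiring baire_eq_generateFrom
    isSigmaSubadditive_content ⟨E, rfl⟩).trans (content_clopen E)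

instance : IsProbabilityMeasure (modelMeasure X) :=
  ⟨by rw [← clopen_top, modelMeasure_clopen, X.μ_top, ENNReal.ofReal_one]⟩

/-- On measurable sets the Carathéodory extension equals the outer measure, an infimum over
countable clopen covers. -/
theorem exists_clopen_cover {S : Set (Stone X)} (hS : MeasurableSet S) {r : ENNReal}
    (hr : modelMeasure X S < r) :
    ∃ E : ℕ → X, S ⊆ (⋃ n, clopen (E n)) ∧ ∑' n, modelMeasure X (clopen (E n)) < r := by
  have hν : modelMeasure X S = inducedOuterMeasure (fun S _ => content X S)
      isSetRing_clopen.empty_mem addContent_empty S :=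
    trim_measurableSet_eq (fun s hs => (OuterMeasure.isCaratheodory_iff _).2
      (AddContent.isCaratheodory_inducedOuterMeasure isSetRing_clopen.isSetSemiring (content X) s
        (baire_eq_generateFrom.le s hs))) hS
  rw [hν, inducedOuterMeasure, OuterMeasure.ofFunction_apply] at hr
  simp only [iInf_lt_iff] at hr
  obtain ⟨t, htS, ht⟩ := hr
  have hmem : ∀ n, t n ∈ Set.range (clopen : X → Set (Stone X)) := by
    intro n
    by_contra hn
    have h1 := (ENNReal.le_tsum n).trans_lt ht
    -- The extended content is `⊤` off the clopen algebra, so a cover of finite total consists of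
    -- clopen sets.
    rw [extend, iInf_neg hn] at h1
    exact not_top_lt h1
  choose E hE using hmem
  obtain rfl : t = fun n => clopen (E n) := funext fun n => (hE n).symm
  refine ⟨E, htS, lt_of_eq_of_lt (tsum_congr fun n => ?_) ht⟩
  rw [extend_eq _ ⟨E n, rfl⟩, content_clopen, modelMeasure_clopen]

/-- The complement of a countable union of clopen sets is closed, hence compact, and a countable
intersection of open sets. It remains to cover `Sᶜ` by clopen sets of total measure below `1 - r`.
-/
theorem innerRegular_modelMeasure :
    (modelMeasure X).InnerRegularWRT (fun K => IsCompact K ∧ IsGδ K) MeasurableSet := by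
  intro S hS r hr
  have hlt : modelMeasure X Sᶜ < 1 - r := by
    rw [prob_compl_eq_one_sub hS]
    rw [lt_tsub_iff_right]
    exact (ENNReal.add_lt_add_left (by finiteness) hr).trans_eq (tsub_add_cancel_of_le prob_le_one)
  obtain ⟨E, hSE, hE⟩ := exists_clopen_cover hS.compl hlt
  have hm : MeasurableSet (⋃ n, clopen (E n)) :=
    MeasurableSet.iUnion fun n => measurableSet_clopen (E n)
  refine ⟨(⋃ n, clopen (E n))ᶜ, Set.compl_subset_comm.1 hSE, ⟨?_, ?_⟩, ?_⟩
  · exact (isOpen_iUnion fun n => isOpen_clopen (E n)).isClosed_compl.isCompact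
  · rw [Set.compl_iUnion]
    exact IsGδ.iInter_of_isOpen fun n => (isClosed_clopen (E n)).isOpen_compl
  · rw [prob_compl_eq_one_sub hm]
    exact lt_tsub_comm.1 ((measure_iUnion_le _).trans_lt hE)

end Stone

/-! ### Laws, the trace formula and uniqueness -/

namespace LInf

variable {X : ProbAlg.{u}}

theorem law_apply (f : LInf X) {B : Set ℂ} (hB : MeasurableSet B) :
    f.law B = ENNReal.ofReal (X.μ (f.val ⟨B, hB⟩)) :=
  Measure.ofMeasurable_apply B hB

instance (f : LInf X) : IsProbabilityMeasure f.law :=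
  ⟨by
    rw [law_apply f MeasurableSet.univ]
    have h : f.val ⟨Set.univ, MeasurableSet.univ⟩ = ⊤ := f.val.map_top
    rw [h, X.μ_top, ENNReal.ofReal_one]⟩

end LInf

namespace MeasureTheory.Measure

/-- A probability measure on a metric space that is dominated by another one on closed sets is
equal to it. -/
theorem eq_of_le_isClosed {Ω : Type*} [MeasurableSpace Ω] [PseudoEMetricSpace Ω] [BorelSpace Ω]
    {ν ν' : Measure Ω} [IsProbabilityMeasure ν] [IsProbabilityMeasure ν']
    (h : ∀ K, IsClosed K → ν K ≤ ν' K) : ν = ν' := by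
  -- Open sets are increasing unions of closed sets, so domination passes to them; taking
  -- complements then reverses it on closed sets.
  have hopen : ∀ V, IsOpen V → ν V ≤ ν' V := by
    intro V hV
    obtain ⟨F, hF, hFV, hUnion, hmono⟩ := hV.exists_iUnion_isClosed
    conv_lhs => rw [← hUnion, hmono.measure_iUnion]
    exact iSup_le fun n => (h (F n) (hF n)).trans (measure_mono (hFV n))
  refine ext_of_generate_finite {K | IsClosed K}
    ((BorelSpace.measurable_eq (α := Ω)).trans borel_eq_generateFrom_isClosed)
    isPiSystem_isClosed (fun K hK => le_antisymm (h K hK) ?_) (by simp)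
  have hK : IsClosed K := hK
  rw [ENNReal.eq_sub_of_add_eq (measure_ne_top ν Kᶜ) (prob_add_prob_compl hK.measurableSet),
    ENNReal.eq_sub_of_add_eq (measure_ne_top ν' Kᶜ) (prob_add_prob_compl hK.measurableSet)]
  exact tsub_le_tsub_left (hopen _ hK.isOpen_compl) 1

end MeasureTheory.Measure

namespace Stone

variable {X : ProbAlg.{u}}

/-- Only the inclusion of `clopen (f^*(K))` in `{x | x(f) ∈ K}` is known for closed `K`, but for two
probability measures this one-sided bound is enough. -/
theorem map_eval_modelMeasure (f : LInf X) :
    (modelMeasure X).map (fun x => x.toFun f) = f.law := by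
  have : IsProbabilityMeasure ((modelMeasure X).map fun x => x.toFun f) :=
    Measure.isProbabilityMeasure_map (measurable_eval f).aemeasurable
  refine (Measure.eq_of_le_isClosed fun K hK => ?_).symm
  rw [LInf.law_apply f hK.measurableSet, Measure.map_apply (measurable_eval f) hK.measurableSet,
    ← modelMeasure_clopen]
  exact measure_mono fun x hx => eval_mem_of_mem_clopen f hK hx

theorem integral_eval_modelMeasure (f : LInf X) :
    ∫ x : Stone X, x.toFun f ∂modelMeasure X = f.trace := by
  rw [LInf.trace, ← map_eval_modelMeasure f,
    integral_map (f := fun z => z) (measurable_eval f).aemeasurable aestronglyMeasurable_id]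

theorem integral_eval_ind (ν : Measure (Stone X)) (E : X) :
    ∫ x : Stone X, x.toFun (LInf.ind E) ∂ν = (ν.real (clopen E) : ℂ) := by
  have h : (fun x : Stone X => x.toFun (LInf.ind E)) =
      (clopen E).indicator fun _ => (1 : ℂ) := by
    funext x
    by_cases hx : x ∈ clopen E
    · rw [Set.indicator_of_mem hx]
      exact hx
    · rw [Set.indicator_of_notMem hx]
      exact (eval_ind x E).resolve_right hx
  rw [h, integral_indicator_const _ (measurableSet_clopen E)]
  simp

theorem isModelMeasure_modelMeasure (X : ProbAlg.{u}) :
    IsModelMeasure X ⟨modelMeasure X, inferInstance⟩ :=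
  ⟨innerRegular_modelMeasure, integral_eval_modelMeasure⟩

/-- The trace formula for indicators fixes `ν` on the clopen sets, a π-system that generates the
Baire σ-algebra. -/
theorem IsModelMeasure.eq_modelMeasure {ν : ProbabilityMeasure (Stone X)}
    (hν : IsModelMeasure X ν) : (ν : Measure (Stone X)) = modelMeasure X := by
  refine ext_of_generate_finite _ baire_eq_generateFrom isPiSystem_clopen ?_ (by simp)
  rintro _ ⟨E, rfl⟩
  have h := (hν.represents (LInf.ind E)).trans (integral_eval_modelMeasure (LInf.ind E)).symm
  rw [integral_eval_ind, integral_eval_ind, Complex.ofReal_inj] at h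
  exact (measureReal_eq_measureReal_iff).1 h

/-! ### Equivariance and the isomorphism of probability algebras -/

theorem measurable_map (T : ProbAlg.Hom X X) : Measurable (map T) := by
  have h := measurable_generateFrom (f := map T)
    (s := Set.range (clopen : X → Set (Stone X))) (by
      rintro _ ⟨E, rfl⟩
      rw [map_preimage_clopen]
      exact measurableSet_clopen _)
  exact fun S hS => h (baire_eq_generateFrom.le S hS)

theorem measurePreserving_map (T : ProbAlg.Hom X X) :
    MeasurePreserving (map T) (modelMeasure X) (modelMeasure X) := by
  refine ⟨measurable_map T, ?_⟩
  have : IsProbabilityMeasure ((modelMeasure X).map (map T)) :=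
    Measure.isProbabilityMeasure_map (measurable_map T).aemeasurable
  refine ext_of_generate_finite _ baire_eq_generateFrom isPiSystem_clopen ?_ (by simp)
  rintro _ ⟨E, rfl⟩
  rw [Measure.map_apply (measurable_map T) (measurableSet_clopen E), map_preimage_clopen,
    modelMeasure_clopen, modelMeasure_clopen, T.μ_pull]

theorem continuous_map (T : ProbAlg.Hom X X) : Continuous (map T) :=
  continuous_induced_rng.2 (continuous_pi fun f => continuous_eval (f.koopman T))

/-- Every Baire set of the canonical model agrees with a clopen set up to a null set. -/
theorem exists_clopen_ae_eq {S : Set (Stone X)} (hS : MeasurableSet S) :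
    ∃ E : X, S =ᵐ[modelMeasure X] clopen E := by
  induction S, hS using MeasurableSpace.induction_on_inter baire_eq_generateFrom
    isPiSystem_clopen with
  | empty => exact ⟨⊥, by rw [clopen_bot]; exact ae_eq_refl _⟩
  | basic S hS =>
    obtain ⟨E, rfl⟩ := hS
    exact ⟨E, ae_eq_refl _⟩
  | compl S hS ih =>
    obtain ⟨E, hE⟩ := ih
    exact ⟨Eᶜ, by rw [clopen_compl]; exact hE.compl⟩
  | iUnion S hd hS ih =>
    choose E hE using ih
    obtain ⟨s, hs⟩ := X.exists_lub E
    refine ⟨s, ?_⟩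
    -- The `S n` are disjoint, so the meets have measure zero and vanish by strict positivity.
    have hdE : Pairwise (fun m n => E m ⊓ E n = ⊥) := by
      intro m n hmn
      refine X.μ_eq_zero (le_antisymm ?_ (X.μ_nonneg _))
      rw [← ENNReal.ofReal_eq_zero, ← modelMeasure_clopen, clopen_inf,
        ← measure_congr ((hE m).inter (hE n)), Set.disjoint_iff_inter_eq_empty.1 (hd hmn),
        measure_empty]
    have hsum := X.μ_hasSum E s hdE hs
    -- The set `clopen s` may exceed the union of the `clopen (E n)`. Countable additivity in `X`
    -- shows that the excess over `⋃ n, S n` is null.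
    have hmeas : modelMeasure X (⋃ n, S n) = modelMeasure X (clopen s) := by
      rw [measure_iUnion hd hS, modelMeasure_clopen, ← hsum.tsum_eq,
        ENNReal.ofReal_tsum_of_nonneg (fun n => X.μ_nonneg _) hsum.summable]
      exact tsum_congr fun n => by rw [measure_congr (hE n), modelMeasure_clopen]
    refine ae_eq_of_ae_subset_of_measure_ge ?_ hmeas.ge
      (MeasurableSet.iUnion hS).nullMeasurableSet (measure_ne_top _ _)
    have hall : ∀ᵐ x ∂modelMeasure X, ∀ n, x ∈ S n → x ∈ clopen (E n) :=
      ae_all_iff.2 fun n => (hE n).le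
    filter_upwards [hall] with x hx hxS
    obtain ⟨n, hn⟩ := Set.mem_iUnion.1 hxS
    exact clopen_mono (hs.1 ⟨n, rfl⟩) (hx n hn)

/-- The order isomorphism of `X` with the measure algebra of its canonical model. -/
def orderIso (X : ProbAlg.{u}) : X ≃o NullQuot (modelMeasure X) :=
  RelIso.ofSurjective
    (OrderEmbedding.ofMapLEIff
      (fun E : X => NullQuot.mk (modelMeasure X) ⟨clopen E, measurableSet_clopen E⟩)
      (fun E F => by
        rw [NullQuot.mk_le]
        refine ⟨fun h => ?_, fun h => Filter.Eventually.of_forall (clopen_mono h)⟩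
        have h0 : modelMeasure X (clopen (E \ F)) = 0 := by
          rw [clopen_sdiff]
          exact ae_le_set.1 h
        rw [modelMeasure_clopen, ENNReal.ofReal_eq_zero] at h0
        exact sdiff_eq_bot_iff.1 (X.μ_eq_zero (h0.antisymm (X.μ_nonneg _)))))
    (fun a => by
      obtain ⟨S, rfl⟩ := NullQuot.exists_rep a
      obtain ⟨E, hE⟩ := exists_clopen_ae_eq S.2
      exact ⟨E, NullQuot.mk_eq.2 hE.symm⟩)

theorem orderIso_apply (E : X) : orderIso X E =
    NullQuot.mk (modelMeasure X) ⟨clopen E, measurableSet_clopen E⟩ := rfl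

theorem measure_orderIso (E : X) : NullQuot.measure (orderIso X E) = X.μ E := by
  change (modelMeasure X).real (clopen E) = _
  rw [measureReal_def, modelMeasure_clopen, ENNReal.toReal_ofReal (X.μ_nonneg E)]

/-- The isomorphism of `X` with the probability algebra of its canonical model. -/
def probAlgIso (X : ProbAlg.{u}) : X ≅ probAlgOf (modelMeasure X) where
  -- Morphisms point against their pullbacks, so `hom` carries the inverse order isomorphism.
  hom := (⟨SigmaHom.ofOrderIso (orderIso X).symm, fun a => by
    obtain ⟨E, rfl⟩ := (orderIso X).surjective a
    change X.μ ((orderIso X).symm (orderIso X E)) = NullQuot.measure (orderIso X E)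
    rw [OrderIso.symm_apply_apply, measure_orderIso]⟩ : ProbAlg.Hom X (probAlgOf _))
  inv := (⟨SigmaHom.ofOrderIso (orderIso X), fun E => measure_orderIso E⟩ :
    ProbAlg.Hom (probAlgOf _) X)
  hom_inv_id := ProbAlg.Hom.ext (SigmaHom.ext (funext (orderIso X).symm_apply_apply))
  inv_hom_id := ProbAlg.Hom.ext (SigmaHom.ext (funext (orderIso X).apply_symm_apply))

/-- Stating this for any `S` equal to `map T` lets it apply to the coercion of a homeomorphism. -/
theorem probAlgIso_hom_naturality (T : X ⟶ X) {S : Stone X → Stone X} (hS : S = map T)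
    (hmp : MeasurePreserving S (modelMeasure X) (modelMeasure X)) :
    (probAlgIso X).hom ≫ (probAlgMap S hmp :
      probAlgOf (modelMeasure X) ⟶ probAlgOf (modelMeasure X)) = T ≫ (probAlgIso X).hom := by
  subst hS
  refine ProbAlg.Hom.ext (SigmaHom.ext (funext fun a => ?_))
  obtain ⟨E, rfl⟩ := (orderIso X).surjective a
  have h := (orderIso X).symm_apply_apply E
  change (orderIso X).symm (NullQuot.mk (modelMeasure X) ⟨map T ⁻¹' clopen E, _⟩) =
    (ProbAlg.Hom.pull T) ((orderIso X).symm (orderIso X E))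
  rw [h, OrderIso.symm_apply_eq, orderIso_apply]
  congr 2
  exact map_preimage_clopen T E

/-- The homeomorphisms of the canonical model induced by an action on the probability algebra. -/
def action {Γ : Type v} [Group Γ] (T : Γ →* End X) : Γ →* (Stone X ≃ₜ Stone X) :=
  -- The product in `End X` is composition in the usual order and `map` is covariant, so no order is
  -- reversed.
  have hmul (γ γ' : Γ) (x : Stone X) : map (T γ) (map (T γ') x) = map (T (γ * γ')) x := by
    rw [T.map_mul]
    rfl
  have hone (x : Stone X) : map (T 1) x = x := by
    rw [T.map_one]
    rfl
  { toFun γ :=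
      { toFun := map (T γ)
        invFun := map (T γ⁻¹)
        left_inv x := by rw [hmul, inv_mul_cancel, hone]
        right_inv x := by rw [hmul, mul_inv_cancel, hone]
        continuous_toFun := continuous_map _
        continuous_invFun := continuous_map _ }
    map_one' := Homeomorph.ext hone
    map_mul' γ γ' := Homeomorph.ext fun x => (hmul γ γ' x).symm }

end Stone

end

theorem theorem1p3 {Γ : Type u} [Group Γ] (X : ProbAlg.{v}) (T : Γ →* End X) :
    CompactSpace (Stone X) ∧ T2Space (Stone X) ∧
    (∃! ν : ProbabilityMeasure (Stone X), Stone.IsModelMeasure X ν) ∧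
    ∀ ν : ProbabilityMeasure (Stone X), Stone.IsModelMeasure X ν →
      ∃ (S : Γ →* (Stone X ≃ₜ Stone X))
        (hS : ∀ γ, MeasurePreserving (S γ) (ν : Measure (Stone X)) (ν : Measure (Stone X))),
        (∀ γ x, S γ x = Stone.map (T γ) x) ∧
        ∃ 𝔄 : X ≅ probAlgOf (ν : Measure (Stone X)),
          ∀ γ, 𝔄.hom ≫ (probAlgMap (S γ) (hS γ) :
              probAlgOf (ν : Measure (Stone X)) ⟶ probAlgOf (ν : Measure (Stone X))) =
            (T γ : X ⟶ X) ≫ 𝔄.hom := by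
  refine ⟨inferInstance, inferInstance, ⟨_, Stone.isModelMeasure_modelMeasure X, fun ν hν =>
    Subtype.ext hν.eq_modelMeasure⟩, fun ν hν => ?_⟩
  -- By uniqueness, an arbitrary model measure is the constructed one.
  obtain rfl : ν = ⟨Stone.modelMeasure X, inferInstance⟩ := Subtype.ext hν.eq_modelMeasure
  exact ⟨Stone.action T, fun γ => Stone.measurePreserving_map (T γ), fun γ x => rfl,
    Stone.probAlgIso X, fun γ => Stone.probAlgIso_hom_naturality (T γ) rfl
      (Stone.measurePreserving_map (T γ))⟩
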